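/- Let $n\ge 3$, $r\ge 2$, $s\ge 2$ be integers. Consider bivariate normal data with general missingness: $n$ complete observations $y_1,\dots,y_n\in\mathbb{R}^2$ of $(X_1,X_2)\sim\mathcal N(\mu,\Sigma)$, $r$ observations $z_1,\dots,z_r\in\mathbb{R}$ of $X_1$ only, and $s$ observations $w_1,\dots,w_s\in\mathbb{R}$ of $X_2$ only. With $\Gamma=\Sigma^{-1}=\begin{pmatrix}\gamma_{11}&\gamma_{12}\\ \gamma_{12}&\gamma_{22}\end{pmatrix}$, let $$\ell(\mu,\Gamma)=\sum_{j=1}^n\log f(y_j)+\sum_{j=1}^r\log f_1(z_j)+\sum_{j=1}^s\log f_2(w_j)$$ be the log-likelihood function on $\mathbb{R}^2\times PD_2$, where $f$, $f_1$, $f_2$ are the densities of $\mathcal N(\mu,\Sigma)$, $\mathcal N(\mu_1,\sigma_{11})$, $\mathcal N(\mu_2,\sigma_{22})$ and $PD_2$ is the set of real positive definite $2\times2$ matrices. Writing bars for averages over the respective sample, the score equations (the vanishing of the partial derivatives of $\ell$) are $$0=n\big[(\overline{Y_1}-\mu_1)\gamma_{11}+(\overline{Y_2}-\mu_2)\gamma_{12}\big]+r\tfrac{\det\Gamma}{\gamma_{22}}(\overline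 Z-\mu_1),$$ $$0=n\big[(\overline{Y_2}-\mu_2)\gamma_{22}+(\overline{Y_1}-\mu_1)\gamma_{12}\big]+s\tfrac{\det\Gamma}{\gamma_{11}}(\overline W-\mu_2),$$ $$0=\tfrac{n+r+s}{2}\tfrac{\gamma_{22}}{\det\Gamma}-\tfrac{s}{2\gamma_{11}}-\tfrac n2(\overline{Y_1^2}-2\mu_1\overline{Y_1}+\mu_1^2)-\tfrac r2 A-\tfrac s2\tfrac{\gamma_{12}^2}{\gamma_{11}^2}B,$$ $$0=\tfrac{n+r+s}{2}\tfrac{\gamma_{11}}{\det\Gamma}-\tfrac{r}{2\gamma_{22}}-\tfrac n2(\overline{Y_2^2}-2\mu_2\overline{Y_2}+\mu_2^2)-\tfrac s2 B-\tfrac r2\tfrac{\gamma_{12}^2}{\gamma_{22}^2}A,$$ $$0=-(n+r+s)\tfrac{\gamma_{12}}{\det\Gamma}-n\big(\overline{Y_1Y_2}-(\overline{Y_1}\mu_2+\overline{Y_2}\mu_1)+\mu_1\mu_2\big)+r\tfrac{\gamma_{12}}{\gamma_{22}}A+s\tfrac{\gamma_{12}}{\gamma_{11}}B,$$ where $A=\overline{Z^2}-2\mu_1\overline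 Z+\mu_1^2$ and $B=\overline{W^2}-2\mu_2\overline W+\mu_2^2$. A complex solution is a point $(\mu_1,\mu_2,\gamma_{11},\gamma_{12},\gamma_{22})\in\mathbb{C}^5$ with $\gamma_{11}\ne0$, $\gamma_{22}\ne0$, $\det\Gamma\neq0$ satisfying all five equations. Then for generic real data $(y,z,w)$, that is, for all data outside the zero set of some nonzero polynomial in the $2n+r+s$ data entries: 1. the score equations have exactly nine complex solutions, i.e. the ML-degree of the bivariate normal missing data problem is $9$; 2. at least one of these solutions is real; 3. at least one real solution lies in $\mathbb{R}^2\times PD_2$ and is a local maximum of $\ell$ there. -/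

import Mathlib

open scoped BigOperators

noncomputable section

namespace BivariateMissing

/-- The parameters `(μ, γ)` of the bivariate normal model over a field `K`: the mean vector
`μ = (μ₁, μ₂)` and the entries `γ = (γ₁₁, γ₁₂, γ₂₂)` of the symmetric matrix `Γ = Σ⁻¹`. -/
abbrev Params (K : Type) : Type := (Fin 2 → K) × (Fin 3 → K)

/-- The symmetric matrix `Γ = Σ⁻¹` with entries `γ₁₁, γ₁₂, γ₂₂`. -/
def concentration {K : Type} (θ : Params K) : Matrix (Fin 2) (Fin 2) K :=
  !![θ.2 0, θ.2 1; θ.2 1, θ.2 2]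

/-- The inclusion of the real parameters into the complex parameters. -/
def toComplex (θ : Params ℝ) : Params ℂ :=
  (fun i => (θ.1 i : ℂ), fun i => (θ.2 i : ℂ))

/-- The statistically relevant parameter space `ℝ² × PD₂`. -/
def parameterSpace : Set (Params ℝ) := {θ | (concentration θ).PosDef}

/-- The density of the bivariate normal distribution with mean `m` and covariance matrix `Γ⁻¹`. -/
def bivariateNormalPDF (m : Fin 2 → ℝ) (Γ : Matrix (Fin 2) (Fin 2) ℝ) (x : Fin 2 → ℝ) : ℝ :=
  Real.sqrt Γ.det / (2 * Real.pi) * Real.exp (-(1 / 2) * ((x - m) ⬝ᵥ (Γ.mulVec (x - m))))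

/-- The log-likelihood of the observed data: `n` complete cases `y j`, `r` cases `z j` in which
only `X₁ ∼ N(μ₁, σ₁₁)` is observed, and `s` cases `w j` in which only `X₂ ∼ N(μ₂, σ₂₂)` is
observed, where `Σ = Γ⁻¹`. -/
def logLikelihood {n r s : ℕ} (y : Fin n → Fin 2 → ℝ) (z : Fin r → ℝ) (w : Fin s → ℝ)
    (θ : Params ℝ) : ℝ :=
  (∑ j, Real.log (bivariateNormalPDF θ.1 (concentration θ) (y j)))
    + (∑ j, Real.log (ProbabilityTheory.gaussianPDFReal (θ.1 0)
        ((concentration θ)⁻¹ 0 0).toNNReal (z j)))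
    + (∑ j, Real.log (ProbabilityTheory.gaussianPDFReal (θ.1 1)
        ((concentration θ)⁻¹ 1 1).toNNReal (w j)))

/-- The average of a finite list of numbers. -/
def average {K : Type} [Field K] {k : ℕ} (f : Fin k → K) : K := (∑ j, f j) / (k : K)

/-- The score equations in `(μ, Γ)`: all five partial derivatives of the log-likelihood function
vanish. They are equations between rational functions, so a solution is required not to annihilate
the denominators `γ₁₁`, `γ₂₂`, `det Γ`. -/
def IsCriticalPoint {K : Type} [Field K] {n r s : ℕ} (y : Fin n → Fin 2 → K) (z : Fin r → K)
    (w : Fin s → K) (θ : Params K) : Prop :=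
  let m₁ := θ.1 0
  let m₂ := θ.1 1
  let g₁₁ := θ.2 0
  let g₁₂ := θ.2 1
  let g₂₂ := θ.2 2
  let D := (concentration θ).det
  let N : K := (n : K) + r + s
  let Y₁ := average fun j => y j 0
  let Y₂ := average fun j => y j 1
  let Y₁₁ := average fun j => y j 0 ^ 2
  let Y₁₂ := average fun j => y j 0 * y j 1
  let Y₂₂ := average fun j => y j 1 ^ 2
  let Z := average z
  let ZZ := average fun j => z j ^ 2
  let W := average w
  let WW := average fun j => w j ^ 2
  g₁₁ ≠ 0 ∧ g₂₂ ≠ 0 ∧ D ≠ 0 ∧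
  -- derivative with respect to `μ₁`
  n * ((Y₁ - m₁) * g₁₁ + (Y₂ - m₂) * g₁₂) + r * (D / g₂₂) * (Z - m₁) = 0 ∧
  -- derivative with respect to `μ₂`
  n * ((Y₂ - m₂) * g₂₂ + (Y₁ - m₁) * g₁₂) + s * (D / g₁₁) * (W - m₂) = 0 ∧
  -- derivative with respect to `γ₁₁`
  1 / 2 * N * (g₂₂ / D) - 1 / 2 * (s / g₁₁) - n / 2 * (Y₁₁ - 2 * m₁ * Y₁ + m₁ ^ 2)
    - r / 2 * (ZZ - 2 * m₁ * Z + m₁ ^ 2)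
    - s / 2 * (g₁₂ ^ 2 / g₁₁ ^ 2) * (WW - 2 * m₂ * W + m₂ ^ 2) = 0 ∧
  -- derivative with respect to `γ₂₂`
  1 / 2 * N * (g₁₁ / D) - 1 / 2 * (r / g₂₂) - n / 2 * (Y₂₂ - 2 * m₂ * Y₂ + m₂ ^ 2)
    - s / 2 * (WW - 2 * m₂ * W + m₂ ^ 2)
    - r / 2 * (g₁₂ ^ 2 / g₂₂ ^ 2) * (ZZ - 2 * m₁ * Z + m₁ ^ 2) = 0 ∧
  -- derivative with respect to `γ₁₂`
  -(N * (g₁₂ / D)) - n * (Y₁₂ - (Y₁ * m₂ + Y₂ * m₁) + m₁ * m₂)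
    + r * (g₁₂ / g₂₂) * (ZZ - 2 * m₁ * Z + m₁ ^ 2)
    + s * (g₁₂ / g₁₁) * (WW - 2 * m₂ * W + m₂ ^ 2) = 0

/-- The set of complex solutions of the score equations for real data. -/
def complexCriticalPoints {n r s : ℕ} (y : Fin n → Fin 2 → ℝ) (z : Fin r → ℝ) (w : Fin s → ℝ) :
    Set (Params ℂ) :=
  {θ | IsCriticalPoint (fun j i => (y j i : ℂ)) (fun j => (z j : ℂ)) (fun j => (w j : ℂ)) θ}

/-- A property holds for generic data if it holds for all data at which some nonzero polynomial in
the `2n + r + s` data entries does not vanish. -/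
def ForGenericData (n r s : ℕ)
    (P : (Fin n → Fin 2 → ℝ) → (Fin r → ℝ) → (Fin s → ℝ) → Prop) : Prop :=
  ∃ F : MvPolynomial ((Fin n × Fin 2) ⊕ (Fin r ⊕ Fin s)) ℝ, F ≠ 0 ∧
    ∀ (y : Fin n → Fin 2 → ℝ) (z : Fin r → ℝ) (w : Fin s → ℝ),
      MvPolynomial.eval (Sum.elim (fun p => y p.1 p.2) (Sum.elim z w)) F ≠ 0 → P y z w

/-- `d` is the ML-degree: the number of complex solutions of the score equations is `d` for generic
data. -/
def IsMLDegree (n r s : ℕ) (d : ℕ) : Prop :=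
  ForGenericData n r s fun y z w => (complexCriticalPoints y z w).encard = d

end BivariateMissing

end

/-! Put `u = σ₁₂/σ₁₁`, `v = σ₁₂/σ₂₂`, `t = u * v` (the squared correlation), and let `ρ = r/(n+r)`,
`σ = s/(n+s)`. When `γ₁₂ ≠ 0` the score equations become two linear equations `H + σ v K = α`, `K +
ρ u H = β` for the rescaled means, where `α`, `β` are the differences between the marginal and
complete sample means, a formula for the remaining scale `ω`, and two equations free of `ω`. In
terms of `t` and the proportion `p = σ v K / α` the last two are polynomial equations `eqA = eqB =
0`, each quadratic in `p` with constant term divisible by `t` (`isCriticalPoint_paramOf_iff`). Their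
resultant in `p` is `t * elim t`, where `elim` has degree at most 9 and `t ^ 9`-coefficient `ρ ^ 6 *
σ ^ 8 * (A * B) ^ 2` (`elim_degree_coeff`). If `elim` has simple roots and nothing needed to return
from `t` to the parameters vanishes at them (`Nondegenerate`), the critical points correspond
bijectively to the nine roots (`setOf_isCriticalPoint_eq`).

Nondegeneracy is generic. The conditions at the roots of `elim` say that two polynomials in `t` have
no common root, so a resultant with coefficients in the ring of data polynomials detects them
(`exists_nondegenerate_locus`); it remains to find one nondegenerate data set. In a family with `A`
and `B` free, each failure pins `B`, and then `A`, to finitely many values (`exists_nondegenerate`),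
and actual data realize the family.

For the real statements, nondegeneracy makes the sample covariance of the complete cases positive
definite and the marginal variances positive. The likelihood then has superlevel sets inside compact
subsets of the open set `ℝ² × PD₂`, so it has a global maximum there (`exists_isMaxOn`), which is a
critical point. -/

namespace BivariateMissing

open Polynomial

/-! ### Resultants and common roots under specialization -/

/-- A polynomial in the coefficients of `f` and `g`, nonzero at one specialization at which `f`
keeps its degree and has no common root with `g`, and zero at all specializations with a common
root. -/
lemma exists_ne_zero_of_no_common_root {D : Type*} [CommRing D] (φ : D →+* ℂ) (f g : D[X]) {m : ℕ}
    (hm : m ≠ 0) (hf : f.natDegree ≤ m) (hc : φ (f.coeff m) ≠ 0)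
    (h : ∀ t, (f.map φ).eval t = 0 → (g.map φ).eval t ≠ 0) :
    ∃ q : D, φ q ≠ 0 ∧ ∀ (ψ : D →+* ℂ) (t : ℂ),
      (f.map ψ).eval t = 0 → (g.map ψ).eval t = 0 → ψ q = 0 := by
  refine ⟨f.resultant g m g.natDegree, ?_, fun ψ t h1 h2 => ?_⟩
  · have hd : (f.map φ).natDegree = m := by
      refine le_antisymm (natDegree_map_le.trans hf) (le_natDegree_of_ne_zero ?_)
      rwa [coeff_map]
    have hne : f.map φ ≠ 0 := by
      rintro h0
      rw [h0] at hd
      exact hm (by simpa using hd.symm)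
    rw [← resultant_map_map]
    -- `f` keeps degree `m` under `φ`, so the product formula over the roots of `f` is valid even if
    -- the degree of `g` drops.
    have := resultant_eq_prod_eval (f.map φ) (g.map φ) g.natDegree natDegree_map_le
      (IsAlgClosed.splits _)
    rw [hd] at this
    rw [this]
    refine mul_ne_zero (pow_ne_zero _ (by simpa using hne)) ?_
    intro h0
    obtain ⟨t, ht, h2⟩ := Multiset.mem_map.1 (Multiset.prod_eq_zero_iff.1 h0)
    exact h t ((mem_roots hne).1 ht) h2
  -- The resultant is a combination `p * f + q * g`, hence vanishes wherever both do.
  · obtain ⟨p, q, -, -, e⟩ :=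
      exists_mul_add_mul_eq_C_resultant f g hf le_rfl (Or.inl hm)
    have := congrArg (fun P => (P.map ψ).eval t) e
    simpa [h1, h2] using this.symm

/-! ### The two quadratics in `p` and their eliminant -/

/-- Normalized sufficient statistics: the missingness rates `ρ = r / (n + r)`, `σ = s / (n + s)`
and rescaled sample moments. -/
structure Stats (K : Type*) where
  ρ : K
  σ : K
  κ : K
  x : K
  y : K
  z : K
  A : K
  B : K

namespace Stats

/-- Transport of statistics along a map. -/
def map {K L : Type*} (f : K → L) (d : Stats K) : Stats L :=
  ⟨f d.ρ, f d.σ, f d.κ, f d.x, f d.y, f d.z, f d.A, f d.B⟩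

section defs

variable {K : Type*} [CommRing K] (d : Stats K) (t p : K)

/-- The normalized regression coefficient. -/
def slope : K := d.ρ * d.σ * t + (1 - d.ρ * d.σ * t) * p

/-- The equation obtained from the score equations that involves the variance of `w`. -/
def eqB : K :=
  (d.z - (1 - t) * d.B) * d.slope t p ^ 2 - (1 + d.σ * t) * d.y * d.slope t p + d.σ * t * d.x
    - d.κ * (1 - t) * p * ((1 - d.σ) * p + d.ρ * d.σ * (1 - d.σ * t) * (1 - p))

/-- The part of `eqA` that does not involve the variance of `z`. -/
def eqA₀ : K :=
  d.z * d.slope t p ^ 2 - d.σ * (1 + d.ρ * t) * d.y * d.slope t p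
    + d.σ ^ 2 * d.ρ * (t * d.x + d.κ * (1 - t) * (1 - p) * (-(1 - t) * p - (1 - d.ρ) * t))

/-- The equation obtained from the score equations that involves the variance of `z`. -/
def eqA : K := d.eqA₀ t p - d.σ ^ 2 * d.ρ * t * (1 - t) * d.A

/-- A multiple of the covariance. -/
def cov : K :=
  d.σ ^ 2 * t * d.x + d.slope t p ^ 2 * d.z - d.σ * (1 + t) * d.y * d.slope t p
    - d.σ ^ 2 * d.ρ * d.κ * (1 - t) ^ 2 * p * (1 - p)

/-- As quadratics in `p`, `eqA` has coefficients `a₂, a₁, t * a₀` and `eqB` has `b₂, b₁, t * b₀`.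
The common factor `t` in the constant terms is split off here, because it would otherwise give the
resultant a spurious root at `t = 0`. -/
def a₂ : K := d.z * (1 - d.ρ * d.σ * t) ^ 2 + d.σ ^ 2 * d.ρ * d.κ * (1 - t) ^ 2

def a₁ : K :=
  2 * d.z * (d.ρ * d.σ * t) * (1 - d.ρ * d.σ * t)
    - d.σ * (1 + d.ρ * t) * d.y * (1 - d.ρ * d.σ * t)
    + d.σ ^ 2 * d.ρ * d.κ * (1 - t) * (-(1 - t) + (1 - d.ρ) * t)

def a₀ : K :=
  d.z * d.ρ ^ 2 * d.σ ^ 2 * t - d.ρ * d.σ ^ 2 * (1 + d.ρ * t) * d.y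
    + d.σ ^ 2 * d.ρ * (d.x - (1 - t) * d.A - d.κ * (1 - t) * (1 - d.ρ))

def b₂ : K :=
  (d.z - (1 - t) * d.B) * (1 - d.ρ * d.σ * t) ^ 2
    - d.κ * (1 - t) * ((1 - d.σ) - d.ρ * d.σ * (1 - d.σ * t))

def b₁ : K :=
  2 * (d.z - (1 - t) * d.B) * (d.ρ * d.σ * t) * (1 - d.ρ * d.σ * t)
    - (1 + d.σ * t) * d.y * (1 - d.ρ * d.σ * t) - d.κ * (1 - t) * d.ρ * d.σ * (1 - d.σ * t)

def b₀ : K :=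
  (d.z - (1 - t) * d.B) * d.ρ ^ 2 * d.σ ^ 2 * t - (1 + d.σ * t) * d.y * (d.ρ * d.σ) + d.σ * d.x

def minor₂₁ : K := d.a₂ t * d.b₁ t - d.a₁ t * d.b₂ t

def minor₂₀ : K := d.a₂ t * d.b₀ t - d.a₀ t * d.b₂ t

def minor₁₀ : K := d.a₁ t * d.b₀ t - d.a₀ t * d.b₁ t

/-- The eliminant: the resultant of `eqA` and `eqB` with respect to `p`, divided by `t`. -/
def elim : K := t * d.minor₂₀ t ^ 2 - d.minor₂₁ t * d.minor₁₀ t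

/-- `slope` at the common root `p = -t * minor₂₀ / minor₂₁`, with the denominator cleared. -/
def slopeNum : K :=
  d.ρ * d.σ * t * d.minor₂₁ t - (1 - d.ρ * d.σ * t) * (t * d.minor₂₀ t)

/-- `cov` at the common root `p = -t * minor₂₀ / minor₂₁`, with the denominator cleared. -/
def covNum : K :=
  d.σ ^ 2 * t * d.x * d.minor₂₁ t ^ 2 + d.slopeNum t ^ 2 * d.z
    - d.σ * (1 + t) * d.y * d.slopeNum t * d.minor₂₁ t
    + d.σ ^ 2 * d.ρ * d.κ * (1 - t) ^ 2 * (t * d.minor₂₀ t) * (d.minor₂₁ t + t * d.minor₂₀ t)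

lemma eqA_eq : d.eqA t p = d.a₂ t * p ^ 2 + d.a₁ t * p + t * d.a₀ t := by
  simp only [eqA, eqA₀, slope, a₂, a₁, a₀]; ring

lemma eqB_eq : d.eqB t p = d.b₂ t * p ^ 2 + d.b₁ t * p + t * d.b₀ t := by
  simp only [eqB, slope, b₂, b₁, b₀]; ring

variable {t p}

/-- Eliminating `p ^ 2` leaves a linear equation, so `t` determines `p` as soon as `minor₂₁ t ≠ 0`.
-/
lemma minor_linear (hA : d.eqA t p = 0) (hB : d.eqB t p = 0) :
    d.minor₂₁ t * p + t * d.minor₂₀ t = 0 := by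
  rw [eqA_eq] at hA
  rw [eqB_eq] at hB
  simp only [minor₂₁, minor₂₀]
  linear_combination d.a₂ t * hB - d.b₂ t * hA

/-- Eliminating `p ^ 2` and `p` in turn gives `minor₂₁ * p = -t * minor₂₀` and `minor₂₁ * p ^ 2 = t
* minor₁₀`; the square of the first is compared with the second. -/
lemma elim_mul_eq_zero (hA : d.eqA t p = 0) (hB : d.eqB t p = 0) : t * d.elim t = 0 := by
  have h1 := d.minor_linear hA hB
  rw [eqA_eq] at hA
  rw [eqB_eq] at hB
  have h3 : d.minor₂₁ t * p ^ 2 - t * d.minor₁₀ t = 0 := by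
    simp only [minor₂₁, minor₁₀]; linear_combination d.b₁ t * hA - d.a₁ t * hB
  simp only [elim]
  linear_combination (t * d.minor₂₀ t - d.minor₂₁ t * p) * h1 + d.minor₂₁ t * h3

end defs

/-! ### Compatibility with ring homomorphisms -/

section map

variable {K L : Type*} [CommRing K] [CommRing L] (f : K →+* L) (d : Stats K) (t p : K)

lemma map_eqA : f (d.eqA t p) = (d.map f).eqA (f t) (f p) := by simp [eqA, eqA₀, slope, map]

lemma map_slope : f (d.slope t p) = (d.map f).slope (f t) (f p) := by simp [slope, map]

lemma map_cov : f (d.cov t p) = (d.map f).cov (f t) (f p) := by simp [cov, slope, map]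

lemma map_a₂ : f (d.a₂ t) = (d.map f).a₂ (f t) := by simp [a₂, map]

lemma map_a₁ : f (d.a₁ t) = (d.map f).a₁ (f t) := by simp [a₁, map, map_ofNat f 2]

lemma map_a₀ : f (d.a₀ t) = (d.map f).a₀ (f t) := by simp [a₀, map]

lemma map_b₂ : f (d.b₂ t) = (d.map f).b₂ (f t) := by simp [b₂, map]

lemma map_b₁ : f (d.b₁ t) = (d.map f).b₁ (f t) := by simp [b₁, map, map_ofNat f 2]

lemma map_b₀ : f (d.b₀ t) = (d.map f).b₀ (f t) := by simp [b₀, map]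

lemma map_minor₂₁ : f (d.minor₂₁ t) = (d.map f).minor₂₁ (f t) := by
  simp [minor₂₁, map_a₂, map_a₁, map_b₂, map_b₁]

lemma map_minor₂₀ : f (d.minor₂₀ t) = (d.map f).minor₂₀ (f t) := by
  simp [minor₂₀, map_a₂, map_a₀, map_b₂, map_b₀]

lemma map_minor₁₀ : f (d.minor₁₀ t) = (d.map f).minor₁₀ (f t) := by
  simp [minor₁₀, map_a₁, map_a₀, map_b₁, map_b₀]

lemma map_elim : f (d.elim t) = (d.map f).elim (f t) := by
  simp [elim, map_minor₂₁, map_minor₂₀, map_minor₁₀]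

lemma map_slopeNum : f (d.slopeNum t) = (d.map f).slopeNum (f t) := by
  simp [slopeNum, map_minor₂₁, map_minor₂₀]; simp [map]

lemma map_covNum : f (d.covNum t) = (d.map f).covNum (f t) := by
  simp [covNum, map_slopeNum, map_minor₂₁, map_minor₂₀]; simp [map]

end map

/-! ### Degree and leading coefficient of the eliminant -/

section poly

variable {K : Type*} [CommRing K] (d : Stats K)

/-- The statistics as constant polynomials. -/
noncomputable def toPoly : Stats K[X] := d.map C

lemma toPoly_map {L : Type*} [CommRing L] (f : K →+* L) :
    d.toPoly.map (Polynomial.map f) = (d.map f).toPoly := by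
  simp [toPoly, map]

lemma toPoly_eval (t : K) : d.toPoly.map (Polynomial.eval t) = d := by
  simp [toPoly, map]

/-- The minors have degrees at most 4, 5 and 4, so both terms have degree at most 9, and the top
coefficient depends only on the top coefficients of the six entries; the full eliminant is never
expanded. -/
lemma elim_coeff_aux {a₂ a₁ a₀ b₂ b₁ b₀ : K[X]} (ha₂ : a₂.natDegree ≤ 2) (ha₁ : a₁.natDegree ≤ 2)
    (ha₀ : a₀.natDegree ≤ 1) (hb₂ : b₂.natDegree ≤ 3) (hb₁ : b₁.natDegree ≤ 3)
    (hb₀ : b₀.natDegree ≤ 2) :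
    (X * (a₂ * b₀ - a₀ * b₂) ^ 2 - (a₂ * b₁ - a₁ * b₂) * (a₁ * b₀ - a₀ * b₁)).natDegree ≤ 9 ∧
    (X * (a₂ * b₀ - a₀ * b₂) ^ 2 - (a₂ * b₁ - a₁ * b₂) * (a₁ * b₀ - a₀ * b₁)).coeff 9 =
      (a₂.coeff 2 * b₀.coeff 2 - a₀.coeff 1 * b₂.coeff 3) ^ 2
        - (a₂.coeff 2 * b₁.coeff 3 - a₁.coeff 2 * b₂.coeff 3)
          * (a₁.coeff 2 * b₀.coeff 2 - a₀.coeff 1 * b₁.coeff 3) := by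
  have mul {p q : K[X]} {i j : ℕ} (hp : p.natDegree ≤ i) (hq : q.natDegree ≤ j) :
      (p * q).natDegree ≤ i + j := natDegree_mul_le_of_le hp hq
  have sub {p q : K[X]} {i : ℕ} (hp : p.natDegree ≤ i) (hq : q.natDegree ≤ i) :
      (p - q).natDegree ≤ i := by simpa using natDegree_sub_le_of_le hp hq
  have h1 : (a₂ * b₀ - a₀ * b₂).natDegree ≤ 4 := sub (mul ha₂ hb₀) (mul ha₀ hb₂)
  have h2 : (a₂ * b₁ - a₁ * b₂).natDegree ≤ 5 := sub (mul ha₂ hb₁) (mul ha₁ hb₂)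
  have h3 : (a₁ * b₀ - a₀ * b₁).natDegree ≤ 4 := sub (mul ha₁ hb₀) (mul ha₀ hb₁)
  have h4 : ((a₂ * b₀ - a₀ * b₂) ^ 2).natDegree ≤ 8 := by
    simpa using natDegree_pow_le_of_le 2 h1
  have h5 : (X : K[X]).natDegree ≤ 1 := natDegree_X_le
  refine ⟨sub (mul h5 h4) (mul h2 h3), ?_⟩
  have e1 : (X * (a₂ * b₀ - a₀ * b₂) ^ 2).coeff 9 = ((a₂ * b₀ - a₀ * b₂) ^ 2).coeff 8 :=
    coeff_X_mul _ 8
  have e2 : ((a₂ * b₀ - a₀ * b₂) ^ 2).coeff 8 = (a₂ * b₀ - a₀ * b₂).coeff 4 ^ 2 := by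
    rw [pow_two, pow_two]; exact coeff_mul_add_eq_of_natDegree_le (df := 4) (dg := 4) h1 h1
  have e3 := coeff_mul_add_eq_of_natDegree_le (df := 5) (dg := 4) h2 h3
  norm_num at e3
  rw [coeff_sub, e1, e2, e3, coeff_sub,
    coeff_mul_add_eq_of_natDegree_le (df := 2) (dg := 2) ha₂ hb₀,
    coeff_mul_add_eq_of_natDegree_le (df := 1) (dg := 3) ha₀ hb₂,
    coeff_mul_add_eq_of_natDegree_le (df := 2) (dg := 3) ha₂ hb₁,
    coeff_mul_add_eq_of_natDegree_le (df := 2) (dg := 3) ha₁ hb₂,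
    coeff_mul_add_eq_of_natDegree_le (df := 2) (dg := 2) ha₁ hb₀,
    coeff_mul_add_eq_of_natDegree_le (df := 1) (dg := 3) ha₀ hb₁]

lemma natDegree_a₂_le : (d.toPoly.a₂ X).natDegree ≤ 2 := by
  simp only [toPoly, map, a₂]; compute_degree

lemma coeff_a₂ : (d.toPoly.a₂ X).coeff 2 = d.z * (d.ρ * d.σ) ^ 2 + d.σ ^ 2 * d.ρ * d.κ := by
  -- The polynomial is exhibited with all its coefficients so that the leading one can be read off;
  -- the lower ones play no further role. The same device serves for the other coefficients.
  have quad (p q r : K) : (C p * X ^ 2 + C q * X + C r).coeff 2 = p := by compute_degree!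
  rw [← quad (d.z * (d.ρ * d.σ) ^ 2 + d.σ ^ 2 * d.ρ * d.κ)
    (-2 * d.z * d.ρ * d.σ - 2 * d.σ ^ 2 * d.ρ * d.κ) (d.z + d.σ ^ 2 * d.ρ * d.κ)]
  congr 1
  simp only [toPoly, map, a₂, C_add, C_mul, C_sub, C_pow, C_neg, C_ofNat]; ring

lemma natDegree_a₁_le : (d.toPoly.a₁ X).natDegree ≤ 2 := by
  simp only [toPoly, map, a₁]; compute_degree

lemma coeff_a₁ : (d.toPoly.a₁ X).coeff 2 = -2 * d.z * (d.ρ * d.σ) ^ 2 + d.σ ^ 2 * d.ρ ^ 2 * d.y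
      - d.σ ^ 2 * d.ρ * d.κ * (2 - d.ρ) := by
  have quad (p q r : K) : (C p * X ^ 2 + C q * X + C r).coeff 2 = p := by compute_degree!
  rw [← quad (-2 * d.z * (d.ρ * d.σ) ^ 2 + d.σ ^ 2 * d.ρ ^ 2 * d.y
    - d.σ ^ 2 * d.ρ * d.κ * (2 - d.ρ)) (2 * d.z * d.ρ * d.σ - d.σ * d.y * d.ρ
    + d.σ * d.y * d.ρ * d.σ + d.σ ^ 2 * d.ρ * d.κ * (3 - d.ρ))
    (- d.σ * d.y - d.σ ^ 2 * d.ρ * d.κ)]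
  congr 1
  simp only [toPoly, map, a₁, C_add, C_mul, C_sub, C_pow, C_neg, C_ofNat]; ring

lemma natDegree_a₀_le : (d.toPoly.a₀ X).natDegree ≤ 1 := by
  simp only [toPoly, map, a₀]; compute_degree

lemma coeff_a₀ : (d.toPoly.a₀ X).coeff 1 = d.z * d.ρ ^ 2 * d.σ ^ 2 - d.ρ ^ 2 * d.σ ^ 2 * d.y
      + d.σ ^ 2 * d.ρ * (d.A + d.κ * (1 - d.ρ)) := by
  have lin (p q : K) : (C p * X + C q).coeff 1 = p := by compute_degree!
  rw [← lin (d.z * d.ρ ^ 2 * d.σ ^ 2 - d.ρ ^ 2 * d.σ ^ 2 * d.y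
    + d.σ ^ 2 * d.ρ * (d.A + d.κ * (1 - d.ρ))) (- d.ρ * d.σ ^ 2 * d.y
    + d.σ ^ 2 * d.ρ * (d.x - d.A - d.κ * (1 - d.ρ)))]
  congr 1
  simp only [toPoly, map, a₀, C_add, C_mul, C_sub, C_pow, C_neg, C_1]; ring

lemma natDegree_b₂_le : (d.toPoly.b₂ X).natDegree ≤ 3 := by
  simp only [toPoly, map, b₂]; compute_degree

lemma coeff_b₂ : (d.toPoly.b₂ X).coeff 3 = d.B * (d.ρ * d.σ) ^ 2 := by
  have cub (p q r s : K) : (C p * X ^ 3 + C q * X ^ 2 + C r * X + C s).coeff 3 = p := by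
    compute_degree!
  rw [← cub (d.B * (d.ρ * d.σ) ^ 2) ((d.z - d.B) * (d.ρ * d.σ) ^ 2 - 2 * d.B * d.ρ * d.σ
    + d.κ * d.ρ * d.σ ^ 2) (d.B - 2 * (d.z - d.B) * d.ρ * d.σ
    - d.κ * d.ρ * d.σ ^ 2 + d.κ * (1 - d.σ - d.ρ * d.σ))
    (d.z - d.B - d.κ * (1 - d.σ - d.ρ * d.σ))]
  congr 1
  simp only [toPoly, map, b₂, C_add, C_mul, C_sub, C_pow, C_1, C_ofNat]; ring

lemma natDegree_b₁_le : (d.toPoly.b₁ X).natDegree ≤ 3 := by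
  simp only [toPoly, map, b₁]; compute_degree

lemma coeff_b₁ : (d.toPoly.b₁ X).coeff 3 = -2 * d.B * (d.ρ * d.σ) ^ 2 := by
  have cub (p q r s : K) : (C p * X ^ 3 + C q * X ^ 2 + C r * X + C s).coeff 3 = p := by
    compute_degree!
  rw [← cub (-2 * d.B * (d.ρ * d.σ) ^ 2) (2 * d.B * d.ρ * d.σ - 2 * (d.z - d.B) * (d.ρ * d.σ) ^ 2
    + d.σ * d.y * d.ρ * d.σ - d.κ * d.ρ * d.σ * d.σ) (2 * (d.z - d.B) * d.ρ * d.σ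
    - d.σ * d.y + d.y * d.ρ * d.σ + d.κ * d.ρ * d.σ * (1 + d.σ)) (- d.y - d.κ * d.ρ * d.σ)]
  congr 1
  simp only [toPoly, map, b₁, C_add, C_mul, C_sub, C_pow, C_neg, C_1, C_ofNat]; ring

lemma natDegree_b₀_le : (d.toPoly.b₀ X).natDegree ≤ 2 := by
  simp only [toPoly, map, b₀]; compute_degree

lemma coeff_b₀ : (d.toPoly.b₀ X).coeff 2 = d.B * (d.ρ * d.σ) ^ 2 := by
  have quad (p q r : K) : (C p * X ^ 2 + C q * X + C r).coeff 2 = p := by compute_degree!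
  rw [← quad (d.B * (d.ρ * d.σ) ^ 2) ((d.z - d.B) * (d.ρ * d.σ) ^ 2 - d.σ * d.y * d.ρ * d.σ)
    (- d.y * d.ρ * d.σ + d.σ * d.x)]
  congr 1
  simp only [toPoly, map, b₀, C_add, C_mul, C_sub, C_pow, C_neg]; ring

/-- The top coefficients of `b₂, b₁, b₀` are `b, -2b, b` with `b = B * (ρ * σ) ^ 2`, so the
coefficient is `b ^ 2` times the square of the sum of the top coefficients of `a₂, a₁, a₀`. In that
sum everything cancels except `σ ^ 2 * ρ * A`. -/
lemma elim_degree_coeff : (d.toPoly.elim X).natDegree ≤ 9 ∧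
    (d.toPoly.elim X).coeff 9 = d.ρ ^ 6 * d.σ ^ 8 * (d.A * d.B) ^ 2 := by
  obtain ⟨h1, h2⟩ := elim_coeff_aux d.natDegree_a₂_le d.natDegree_a₁_le d.natDegree_a₀_le
    d.natDegree_b₂_le d.natDegree_b₁_le d.natDegree_b₀_le
  refine ⟨h1, h2.trans ?_⟩
  rw [coeff_a₂, coeff_a₁, coeff_a₀, coeff_b₂, coeff_b₁, coeff_b₀]
  ring

end poly

end Stats

/-! ### Finite exceptional sets, and the derivative of a resultant -/

lemma finite_setOf_eval_eq_zero {P : ℂ[X]} {a : ℂ} (h : P.eval a ≠ 0) :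
    {t | P.eval t = 0}.Finite := by
  have hP : P ≠ 0 := by rintro rfl; simp at h
  simpa using P.finite_setOfPred_isRoot hP

lemma finite_setOf_quadratic {a b c : ℂ} (h : ¬ (a = 0 ∧ b = 0 ∧ c = 0)) :
    {p : ℂ | a * p ^ 2 + b * p + c = 0}.Finite := by
  have hP : (C a * X ^ 2 + C b * X + C c : ℂ[X]) ≠ 0 := by
    intro h0
    have e0 := congrArg (eval 0) h0
    have e1 := congrArg (eval 1) h0
    have e2 := congrArg (eval (-1)) h0
    simp at e0 e1 e2
    refine h ⟨?_, ?_, e0⟩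
    · linear_combination (e1 + e2) / 2 - e0
    · linear_combination (e1 - e2) / 2
  convert (C a * X ^ 2 + C b * X + C c : ℂ[X]).finite_setOfPred_isRoot hP using 1
  ext p; simp

/-- For choosing a free parameter: each of finitely many failures is an affine condition on `B` with
nonzero slope, hence excludes one value. -/
lemma finite_setOf_linear {ι : Type*} {T : Set ι} (hT : T.Finite) (c e : ι → ℂ) :
    {B : ℂ | ∃ i ∈ T, e i ≠ 0 ∧ c i + e i * B = 0}.Finite := by
  refine (hT.image fun i => -c i / e i).subset ?_
  rintro B ⟨i, hi, he, h⟩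
  refine ⟨i, hi, ?_⟩
  field_simp
  linear_combination -h

lemma exists_pos_notMem {S : Set ℂ} (hS : S.Finite) : ∃ B : ℝ, 0 < B ∧ (B : ℂ) ∉ S := by
  have h1 : ((fun x : ℝ => (x : ℂ)) ⁻¹' S).Finite := hS.preimage Complex.ofReal_injective.injOn
  obtain ⟨B, hB, h2⟩ := (Set.Ioi_infinite (0 : ℝ)).exists_notMem_finite h1
  exact ⟨B, hB, h2⟩

/-- The derivative of the resultant of two quadratic polynomials at a common root. -/
lemma derivative_resultant_quadratic (a₂ a₁ a₀ b₂ b₁ b₀ : ℂ[X]) {t p : ℂ}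
    (hA : a₂.eval t * p ^ 2 + a₁.eval t * p + a₀.eval t = 0)
    (hB : b₂.eval t * p ^ 2 + b₁.eval t * p + b₀.eval t = 0) :
    (derivative ((a₂ * b₀ - a₀ * b₂) ^ 2 - (a₂ * b₁ - a₁ * b₂) * (a₁ * b₀ - a₀ * b₁))).eval t
      = (a₂.eval t * b₁.eval t - a₁.eval t * b₂.eval t) *
        ((2 * b₂.eval t * p + b₁.eval t) * ((derivative a₂).eval t * p ^ 2
            + (derivative a₁).eval t * p + (derivative a₀).eval t)
          - (2 * a₂.eval t * p + a₁.eval t) * ((derivative b₂).eval t * p ^ 2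
            + (derivative b₁).eval t * p + (derivative b₀).eval t)) := by
  simp only [derivative_sub, derivative_mul, derivative_pow, eval_sub, eval_mul, eval_add,
    Nat.cast_ofNat, eval_ofNat, Nat.add_one_sub_one, pow_one, map_ofNat]
  generalize eval t a₂ = A₂ at *
  generalize eval t a₁ = A₁ at *
  generalize eval t a₀ = A₀ at *
  generalize eval t b₂ = B₂ at *
  generalize eval t b₁ = B₁ at *
  generalize eval t b₀ = B₀ at *
  generalize eval t (derivative a₂) = A₂' at *
  generalize eval t (derivative a₁) = A₁' at *
  generalize eval t (derivative a₀) = A₀' at *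
  generalize eval t (derivative b₂) = B₂' at *
  generalize eval t (derivative b₁) = B₁' at *
  generalize eval t (derivative b₀) = B₀' at *
  -- At a common root, `(p ^ 2, p, 1)` is orthogonal to both coefficient vectors, which makes the
  -- minors proportional to its entries.
  have hK : A₂ * B₀ - A₀ * B₂ = -((A₂ * B₁ - A₁ * B₂) * p) := by
    linear_combination A₂ * hB - B₂ * hA
  have hL : A₁ * B₀ - A₀ * B₁ = (A₂ * B₁ - A₁ * B₂) * p ^ 2 := by
    linear_combination A₁ * hB - B₁ * hA
  rw [hK, hL]
  linear_combination (-(A₂ * B₁ - A₁ * B₂)) * ((2 * p * A₂' + A₁') * hB - (2 * p * B₂' + B₁') * hA)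

namespace Stats

lemma eval_elim (d : Stats ℂ) (t : ℂ) : (d.toPoly.elim X).eval t = d.elim t := by
  simpa [toPoly_eval] using map_elim (evalRingHom t) d.toPoly X

lemma eval_a₂ (d : Stats ℂ) (t : ℂ) : (d.toPoly.a₂ X).eval t = d.a₂ t := by
  simpa [toPoly_eval] using map_a₂ (evalRingHom t) d.toPoly X

lemma eval_a₁ (d : Stats ℂ) (t : ℂ) : (d.toPoly.a₁ X).eval t = d.a₁ t := by
  simpa [toPoly_eval] using map_a₁ (evalRingHom t) d.toPoly X

lemma eval_a₀ (d : Stats ℂ) (t : ℂ) : (d.toPoly.a₀ X).eval t = d.a₀ t := by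
  simpa [toPoly_eval] using map_a₀ (evalRingHom t) d.toPoly X

lemma eval_b₂ (d : Stats ℂ) (t : ℂ) : (d.toPoly.b₂ X).eval t = d.b₂ t := by
  simpa [toPoly_eval] using map_b₂ (evalRingHom t) d.toPoly X

lemma eval_b₁ (d : Stats ℂ) (t : ℂ) : (d.toPoly.b₁ X).eval t = d.b₁ t := by
  simpa [toPoly_eval] using map_b₁ (evalRingHom t) d.toPoly X

lemma eval_b₀ (d : Stats ℂ) (t : ℂ) : (d.toPoly.b₀ X).eval t = d.b₀ t := by
  simpa [toPoly_eval] using map_b₀ (evalRingHom t) d.toPoly X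

lemma eval_minor₂₁ (d : Stats ℂ) (t : ℂ) : (d.toPoly.minor₂₁ X).eval t = d.minor₂₁ t := by
  simpa [toPoly_eval] using map_minor₂₁ (evalRingHom t) d.toPoly X

lemma eval_slopeNum (d : Stats ℂ) (t : ℂ) : (d.toPoly.slopeNum X).eval t = d.slopeNum t := by
  simpa [toPoly_eval] using map_slopeNum (evalRingHom t) d.toPoly X

lemma eval_covNum (d : Stats ℂ) (t : ℂ) : (d.toPoly.covNum X).eval t = d.covNum t := by
  simpa [toPoly_eval] using map_covNum (evalRingHom t) d.toPoly X

/-! ### The common root above a root of the eliminant -/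

section root

variable {K : Type*} [Field K] (d : Stats K) {t : K}

/-- The common root of `eqA` and `eqB` above a root `t` of the eliminant. -/
def root (t : K) : K := -(t * d.minor₂₀ t) / d.minor₂₁ t

lemma root_eq (hM : d.minor₂₁ t ≠ 0) : d.minor₂₁ t * d.root t = -(t * d.minor₂₀ t) := by
  rw [root, mul_div_cancel₀ _ hM]

lemma eqA_root (hM : d.minor₂₁ t ≠ 0) (h : d.elim t = 0) : d.eqA t (d.root t) = 0 := by
  have h1 := d.root_eq hM
  have : d.minor₂₁ t ^ 2 * d.eqA t (d.root t) = 0 := by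
    rw [eqA_eq]
    have : d.minor₂₁ t ^ 2 * (d.a₂ t * d.root t ^ 2 + d.a₁ t * d.root t + t * d.a₀ t)
      = d.a₂ t * (d.minor₂₁ t * d.root t) ^ 2 + d.a₁ t * (d.minor₂₁ t * d.root t) * d.minor₂₁ t
        + t * d.a₀ t * d.minor₂₁ t ^ 2 := by ring
    rw [this, h1]
    -- Laplace expansion of a `3 × 3` determinant with a repeated row.
    have h2 : d.a₂ t * d.minor₁₀ t - d.a₁ t * d.minor₂₀ t + d.a₀ t * d.minor₂₁ t = 0 := by
      simp only [minor₂₁, minor₂₀, minor₁₀]; ring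
    simp only [elim] at h
    linear_combination d.a₂ t * t * h + t * d.minor₂₁ t * h2
  exact (mul_eq_zero.1 this).resolve_left (pow_ne_zero _ hM)

lemma eqB_root (hM : d.minor₂₁ t ≠ 0) (h : d.elim t = 0) : d.eqB t (d.root t) = 0 := by
  have h1 := d.root_eq hM
  have : d.minor₂₁ t ^ 2 * d.eqB t (d.root t) = 0 := by
    rw [eqB_eq]
    have : d.minor₂₁ t ^ 2 * (d.b₂ t * d.root t ^ 2 + d.b₁ t * d.root t + t * d.b₀ t)
      = d.b₂ t * (d.minor₂₁ t * d.root t) ^ 2 + d.b₁ t * (d.minor₂₁ t * d.root t) * d.minor₂₁ t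
        + t * d.b₀ t * d.minor₂₁ t ^ 2 := by ring
    rw [this, h1]
    have h2 : d.b₂ t * d.minor₁₀ t - d.b₁ t * d.minor₂₀ t + d.b₀ t * d.minor₂₁ t = 0 := by
      simp only [minor₂₁, minor₂₀, minor₁₀]; ring
    simp only [elim] at h
    linear_combination d.b₂ t * t * h + t * d.minor₂₁ t * h2
  exact (mul_eq_zero.1 this).resolve_left (pow_ne_zero _ hM)

lemma slopeNum_eq (hM : d.minor₂₁ t ≠ 0) :
    d.slopeNum t = d.minor₂₁ t * d.slope t (d.root t) := by
  have h1 := d.root_eq hM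
  simp only [slopeNum, slope]
  linear_combination -(1 - d.ρ * d.σ * t) * h1

lemma covNum_eq (hM : d.minor₂₁ t ≠ 0) :
    d.covNum t = d.minor₂₁ t ^ 2 * d.cov t (d.root t) := by
  have h1 := d.root_eq hM
  have h2 : t * d.minor₂₀ t = -(d.minor₂₁ t * d.root t) := by rw [h1, neg_neg]
  simp only [covNum, cov, d.slopeNum_eq hM, h2]
  ring

end root

/-! ### Nondegeneracy and the bad locus -/

/-- The nondegeneracy conditions under which there are nine critical points. -/
structure Nondegenerate (d : Stats ℂ) : Prop where
  κ_ne : d.κ ≠ 0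
  -- This excludes critical points with `γ₁₂ = 0`, which the coordinates `u`, `v` do not reach.
  y_ne : d.y + d.ρ * d.σ * d.κ ≠ 0
  A_ne : d.A ≠ 0
  B_ne : d.B ≠ 0
  ne_zero : ∀ t, d.elim t = 0 → t ≠ 0
  ne_one : ∀ t, d.elim t = 0 → 1 - t ≠ 0
  minor_ne : ∀ t, d.elim t = 0 → d.minor₂₁ t ≠ 0
  slope_ne : ∀ t, d.elim t = 0 → d.slopeNum t ≠ 0
  cov_ne : ∀ t, d.elim t = 0 → d.covNum t ≠ 0
  deriv_ne : ∀ t, d.elim t = 0 → (derivative (d.toPoly.elim X)).eval t ≠ 0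

/-- At `t = 0` the middle coefficients are proportional, `a₁ = σ * b₁` with `b₁ = -(y + ρ * σ * κ)`,
so both remaining minors factor. -/
lemma elim_zero {K : Type*} [CommRing K] (d : Stats K) : d.elim 0 =
    -((d.y + d.ρ * d.σ * d.κ) ^ 2 * (d.a₂ 0 - d.σ * d.b₂ 0) * (d.σ * d.b₀ 0 - d.a₀ 0)) := by
  simp only [elim, minor₂₁, minor₁₀, a₁, b₁]; ring

/-- At `t = 1` all terms with `A`, `B` or `κ` carry the factor `1 - t`, leaving only complete-sample
moments. Besides excluding the root `1`, this factorization later yields definiteness of the sample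
covariance. -/
lemma elim_one {K : Type*} [CommRing K] (d : Stats K) : d.elim 1 =
    d.σ ^ 2 * (1 - d.ρ * d.σ) ^ 6 * d.x * d.z * (d.x * d.z - d.y ^ 2) := by
  simp only [elim, minor₂₁, minor₁₀, minor₂₀, a₂, a₁, a₀, b₂, b₁, b₀]; ring

lemma minor₂₁_one {K : Type*} [CommRing K] (d : Stats K) : d.minor₂₁ 1 =
    -(d.z * d.y * (1 - d.ρ * d.σ) ^ 4) := by
  simp only [minor₂₁, a₂, a₁, b₂, b₁]; ring

/-- The statistics as constant bivariate polynomials. -/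
noncomputable def toPoly₂ (d : Stats ℂ) : Stats ℂ[X][X] := d.toPoly.map C

/-- Evaluation of a bivariate polynomial. -/
noncomputable def ev (t p : ℂ) : ℂ[X][X] →+* ℂ := (evalRingHom p).comp (mapRingHom (evalRingHom t))

lemma ev_apply (t p : ℂ) (f : ℂ[X][X]) : ev t p f = (f.map (evalRingHom t)).eval p := rfl

@[simp] lemma ev_C (t p : ℂ) (f : ℂ[X]) : ev t p (C f) = f.eval t := by simp [ev]

@[simp] lemma ev_X (t p : ℂ) : ev t p X = p := by simp [ev]

lemma toPoly₂_ev (d : Stats ℂ) (t p : ℂ) : d.toPoly₂.map (ev t p) = d := by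
  simp [toPoly₂, toPoly, map]

/-- The partial derivative of `eqA` with respect to `t`. -/
noncomputable def dA (d : Stats ℂ) (t p : ℂ) : ℂ :=
  (derivative (d.toPoly.a₂ X)).eval t * p ^ 2 + (derivative (d.toPoly.a₁ X)).eval t * p
    + (derivative (X * d.toPoly.a₀ X)).eval t

/-- The partial derivative of `eqB` with respect to `t`. -/
noncomputable def dB (d : Stats ℂ) (t p : ℂ) : ℂ :=
  (derivative (d.toPoly.b₂ X)).eval t * p ^ 2 + (derivative (d.toPoly.b₁ X)).eval t * p
    + (derivative (X * d.toPoly.b₀ X)).eval t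

/-- The Jacobian determinant of `eqB` and `eqA`. -/
noncomputable def jacobian (d : Stats ℂ) (t p : ℂ) : ℂ :=
  (2 * d.b₂ t * p + d.b₁ t) * d.dA t p - (2 * d.a₂ t * p + d.a₁ t) * d.dB t p

/-- The resultant of `eqA` and `eqB` is `t * elim t`, and the derivative of a resultant at a common
root is `minor₂₁` times the Jacobian. Simplicity of a root of `elim` thus amounts to transversality
of the two curves. -/
lemma derivative_elim (d : Stats ℂ) {t p : ℂ} (hA : d.eqA t p = 0) (hB : d.eqB t p = 0)
    (he : d.elim t = 0) :
    t * (derivative (d.toPoly.elim X)).eval t = d.minor₂₁ t * d.jacobian t p := by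
  rw [eqA_eq] at hA
  rw [eqB_eq] at hB
  have h := derivative_resultant_quadratic (d.toPoly.a₂ X) (d.toPoly.a₁ X) (X * d.toPoly.a₀ X)
    (d.toPoly.b₂ X) (d.toPoly.b₁ X) (X * d.toPoly.b₀ X) (t := t) (p := p)
    (by simpa [eval_a₂, eval_a₁, eval_a₀] using hA)
    (by simpa [eval_b₂, eval_b₁, eval_b₀] using hB)
  have h2 : (d.toPoly.a₂ X * (X * d.toPoly.b₀ X) - X * d.toPoly.a₀ X * d.toPoly.b₂ X) ^ 2
      - (d.toPoly.a₂ X * d.toPoly.b₁ X - d.toPoly.a₁ X * d.toPoly.b₂ X)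
        * (d.toPoly.a₁ X * (X * d.toPoly.b₀ X) - X * d.toPoly.a₀ X * d.toPoly.b₁ X)
      = X * d.toPoly.elim X := by
    simp only [elim, minor₂₁, minor₂₀, minor₁₀]; ring
  rw [h2, derivative_mul, derivative_X, one_mul, eval_add, eval_elim, he, zero_add, eval_mul,
    eval_X, eval_a₂, eval_a₁, eval_b₂, eval_b₁] at h
  exact h

/-- The jacobian multiplied by `t * (1 - t)`, with `A` eliminated by means of `eqA`. -/
noncomputable def redJacobian (d : Stats ℂ) (t p : ℂ) : ℂ :=
  t * (1 - t) * d.jacobian t p - (1 - 2 * t) * d.eqA t p * (2 * d.b₂ t * p + d.b₁ t)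

/-- `A` enters `eqA` as `-σ ^ 2 * ρ * t * (1 - t) * A` and its `t`-derivative with factor `1 - 2 *
t`, so the contributions cancel. The bad points on `eqB = 0` can therefore be determined before `A`
is chosen. -/
lemma redJacobian_congr (ρ σ κ x y z A A' B t p : ℂ) :
    redJacobian ⟨ρ, σ, κ, x, y, z, A, B⟩ t p = redJacobian ⟨ρ, σ, κ, x, y, z, A', B⟩ t p := by
  have h1 : dA ⟨ρ, σ, κ, x, y, z, A, B⟩ t p = dA ⟨ρ, σ, κ, x, y, z, A', B⟩ t p
      - σ ^ 2 * ρ * (1 - 2 * t) * (A - A') := by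
    have e : X * (toPoly ⟨ρ, σ, κ, x, y, z, A, B⟩).a₀ X
        = X * (toPoly ⟨ρ, σ, κ, x, y, z, A', B⟩).a₀ X
          - C (σ ^ 2 * ρ * (A - A')) * (X - X ^ 2) := by
      simp only [toPoly, map, a₀, C_mul, C_sub, C_pow]; ring
    have e' : (derivative (X * (toPoly ⟨ρ, σ, κ, x, y, z, A, B⟩).a₀ X)).eval t
        = (derivative (X * (toPoly ⟨ρ, σ, κ, x, y, z, A', B⟩).a₀ X)).eval t
          - σ ^ 2 * ρ * (1 - 2 * t) * (A - A') := by
      rw [e, derivative_sub, eval_sub, derivative_C_mul, eval_C_mul]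
      simp
      ring
    simp only [dA, e']
    simp only [toPoly, map, a₂, a₁]
    ring
  simp only [redJacobian, jacobian, h1, dB, toPoly, map, b₂, b₁, b₀, eqA, eqA₀, slope, a₂, a₁]
  ring

/-- The conditions to be avoided at the solutions of `eqA` and `eqB`. -/
noncomputable def badLocus (d : Stats ℂ) (t p : ℂ) : ℂ :=
  d.slope t p * d.cov t p * d.redJacobian t p

lemma exists_badLocus_poly (d : Stats ℂ) : ∃ f : ℂ[X][X], ∀ t p, ev t p f = d.badLocus t p := by
  refine ⟨d.toPoly₂.slope (C X) X * d.toPoly₂.cov (C X) X *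
    (C X * (1 - C X) * ((2 * d.toPoly₂.b₂ (C X) * X + d.toPoly₂.b₁ (C X)) *
      (C (derivative (d.toPoly.a₂ X)) * X ^ 2 + C (derivative (d.toPoly.a₁ X)) * X
        + C (derivative (X * d.toPoly.a₀ X)))
      - (2 * d.toPoly₂.a₂ (C X) * X + d.toPoly₂.a₁ (C X)) *
      (C (derivative (d.toPoly.b₂ X)) * X ^ 2 + C (derivative (d.toPoly.b₁ X)) * X
        + C (derivative (X * d.toPoly.b₀ X))))
      - (1 - 2 * C X) * d.toPoly₂.eqA (C X) X
        * (2 * d.toPoly₂.b₂ (C X) * X + d.toPoly₂.b₁ (C X))), fun t p => ?_⟩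
  simp only [_root_.map_mul, _root_.map_sub, _root_.map_add, _root_.map_one, _root_.map_pow,
    map_ofNat, map_slope, map_cov, map_b₂, map_b₁, map_a₂, map_a₁, map_eqA, toPoly₂_ev, ev_C, ev_X,
    eval_X, badLocus, redJacobian, jacobian, dA, dB]

/-- Let `S` be the slope. At `t = 1`, both `cov - eqB` and `eqA - eqB` are nonzero multiples of `S *
y - σ * x`, whose vanishing together with `eqB = 0` would force `x * z = y ^ 2`. The other factor of
the reduced Jacobian is `∂eqB/∂p`, which vanishes only at a double root, excluded by the
discriminant condition. -/
lemma badLocus_one {d : Stats ℂ} {p : ℂ} (hB : d.eqB 1 p = 0)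
    (hρσ : 1 - d.ρ * d.σ ≠ 0) (hσ1 : 1 - d.σ ≠ 0) (hσ : d.σ ≠ 0) (hx : d.x ≠ 0)
    (hD : d.x * d.z - d.y ^ 2 ≠ 0)
    (hE : (1 + d.σ) ^ 2 * d.y ^ 2 - 4 * d.σ * d.x * d.z ≠ 0) : d.badLocus 1 p ≠ 0 := by
  have hV : d.slope 1 p * d.y = d.σ * d.x → False := by
    intro h
    have : d.σ ^ 2 * d.x * (d.x * d.z - d.y ^ 2) = 0 := by
      simp only [eqB] at hB
      linear_combination d.y ^ 2 * hB - (d.z * (d.slope 1 p * d.y + d.σ * d.x) - (1 + d.σ) * d.y ^ 2) * h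
    exact mul_ne_zero (mul_ne_zero (pow_ne_zero _ hσ) hx) hD this
  refine mul_ne_zero (mul_ne_zero ?_ ?_) ?_
  · intro h
    simp only [eqB, h] at hB
    refine mul_ne_zero hσ hx ?_
    linear_combination hB
  · intro h
    apply hV
    refine mul_left_cancel₀ hσ1 ?_
    simp only [eqB] at hB
    simp only [cov] at h
    linear_combination h - hB
  · have : d.redJacobian 1 p = d.eqA 1 p * (2 * d.b₂ 1 * p + d.b₁ 1) := by
      simp only [redJacobian]; ring
    rw [this]
    refine mul_ne_zero ?_ ?_
    · intro h
      apply hV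
      refine mul_left_cancel₀ hρσ ?_
      simp only [eqB] at hB
      simp only [eqA, eqA₀] at h
      linear_combination h - hB
    · intro h
      have h2 : 2 * d.z * d.slope 1 p = (1 + d.σ) * d.y := by
        refine mul_left_cancel₀ hρσ ?_
        simp only [b₂, b₁] at h
        simp only [slope]
        linear_combination h
      apply hE
      simp only [eqB] at hB
      linear_combination (-4 * d.z) * hB + (2 * d.z * d.slope 1 p - (1 + d.σ) * d.y) * h2

/-- The resultant in `p` of `eqB` and the bad locus is a polynomial in `t`, nonzero at `t = 1` by
`badLocus_one`; so finitely many `t` occur, each with finitely many `p` because `eqB` is not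
identically zero in `p`. -/
lemma finite_bad {d : Stats ℂ}
    (hρσ : 1 - d.ρ * d.σ ≠ 0) (hσ1 : 1 - d.σ ≠ 0) (hσ : d.σ ≠ 0) (hx : d.x ≠ 0)
    (hz : d.z ≠ 0) (hD : d.x * d.z - d.y ^ 2 ≠ 0)
    (hE : (1 + d.σ) ^ 2 * d.y ^ 2 - 4 * d.σ * d.x * d.z ≠ 0)
    (hb : ∀ t, t ≠ 0 → t ≠ 1 → ¬ (d.b₂ t = 0 ∧ d.b₁ t = 0 ∧ d.b₀ t = 0)) :
    {tp : ℂ × ℂ | tp.1 ≠ 0 ∧ tp.1 ≠ 1 ∧ d.eqB tp.1 tp.2 = 0 ∧ d.badLocus tp.1 tp.2 = 0}.Finite := by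
  obtain ⟨g, hg⟩ := d.exists_badLocus_poly
  set f : ℂ[X][X] := C (d.toPoly.b₂ X) * X ^ 2 + C (d.toPoly.b₁ X) * X + C (X * d.toPoly.b₀ X)
    with hf
  have hfe (t p : ℂ) : ev t p f = d.eqB t p := by
    simp [hf, eqB_eq, eval_b₂, eval_b₁, eval_b₀]
  have hf2 : f.coeff 2 = d.toPoly.b₂ X := by rw [hf]; compute_degree!
  obtain ⟨q, hq, hq'⟩ := exists_ne_zero_of_no_common_root (evalRingHom 1) f g (m := 2) (by norm_num)
    (by rw [hf]; compute_degree)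
    (by
      rw [hf2, coe_evalRingHom, eval_b₂]
      simp only [b₂]
      ring_nf
      have := mul_ne_zero hz (pow_ne_zero 2 hρσ)
      ring_nf at this
      exact this)
    (fun p h1 h2 => by
      rw [← ev_apply, hfe] at h1
      rw [← ev_apply, hg] at h2
      exact badLocus_one h1 hρσ hσ1 hσ hx hD hE h2)
  have hfin : {t | q.eval t = 0}.Finite := finite_setOf_eval_eq_zero hq
  have : (⋃ t ∈ {t | q.eval t = 0 ∧ t ≠ 0 ∧ t ≠ 1},
      (fun p => (t, p)) '' {p : ℂ | d.b₂ t * p ^ 2 + d.b₁ t * p + t * d.b₀ t = 0}).Finite := by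
    refine Set.Finite.biUnion (hfin.subset fun t ht => ht.1) fun t ht => ?_
    refine (finite_setOf_quadratic fun h => hb t ht.2.1 ht.2.2 ⟨h.1, h.2.1, ?_⟩).image _
    exact (mul_eq_zero.1 h.2.2).resolve_left ht.2.1
  refine this.subset ?_
  rintro ⟨t, p⟩ ⟨h0, h1, hB, hT⟩
  simp only [Set.mem_iUnion]
  refine ⟨t, ⟨?_, h0, h1⟩, p, ?_, rfl⟩
  · refine hq' (evalRingHom t) p ?_ ?_
    · rw [← ev_apply, hfe]; exact hB
    · rw [← ev_apply, hg]; exact hT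
  · rw [Set.mem_ofPred_eq, ← eqB_eq]; exact hB

/-! ### One nondegenerate choice of statistics -/

/-- A family of statistics in which `A` and `B` are free. -/
noncomputable def sample (ρ σ A B : ℂ) : Stats ℂ := ⟨ρ, σ, 1, 1, σ / 2, 1, A, B⟩

section

variable {ρ σ : ℝ} (hρ0 : 0 < ρ) (hρ1 : ρ < 1) (hσ0 : 0 < σ) (hσ1 : σ < 1)

lemma ofReal_one_sub_mul_ne (hρ0 : 0 < ρ) (hρ1 : ρ < 1) (hσ1 : σ < 1) : 1 - (ρ : ℂ) * σ ≠ 0 := by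
  have : 1 - ρ * σ ≠ 0 := by nlinarith
  exact_mod_cast this

include hρ0 hρ1 hσ0 hσ1

lemma exists_good_B : ∃ B : ℝ, 0 < B ∧
    (∀ A t : ℂ, t ≠ 0 → t ≠ 1 → ¬ ((sample ρ σ A B).b₂ t = 0 ∧ (sample ρ σ A B).b₁ t = 0 ∧
      (sample ρ σ A B).b₀ t = 0)) ∧
    (∀ A t : ℂ, t ≠ 0 → t ≠ 1 → ¬ ((sample ρ σ A B).a₂ t = 0 ∧ (sample ρ σ A B).b₂ t = 0)) ∧
    (∀ A : ℂ, (sample ρ σ A B).a₂ 0 - σ * (sample ρ σ A B).b₂ 0 ≠ 0) := by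
  have hρσ := ofReal_one_sub_mul_ne hρ0 hρ1 hσ1
  have hρ : (ρ : ℂ) ≠ 0 := by exact_mod_cast hρ0.ne'
  have hσ : (σ : ℂ) ≠ 0 := by exact_mod_cast hσ0.ne'
  -- Up to the factor `σ * t`, this is `eqB` at `p = -ρσt / (1 - ρσt)` with denominators cleared.
  -- There the slope is zero, so `B` drops out.
  set f : ℂ[X] := (1 - C (ρ * σ : ℂ) * X) ^ 2
    + (1 - X) * (C ((ρ : ℂ) ^ 2 * σ) * (1 - C (σ : ℂ) * X)
      - C ((1 - (σ : ℂ)) * (ρ : ℂ) ^ 2 * σ) * X) with hf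
  have hf1 : f.eval 1 ≠ 0 := by simpa [hf] using hρσ
  have ha1 : ((sample ρ σ 0 0).toPoly.a₂ X).eval 1 ≠ 0 := by
    rw [eval_a₂]; simpa [a₂, sample] using hρσ
  have F1 := finite_setOf_linear (finite_setOf_eval_eq_zero hf1)
    (fun t => (sample ρ σ 0 0).b₀ t) (fun t => (t - 1) * (ρ : ℂ) ^ 2 * (σ : ℂ) ^ 2 * t)
  have F2 := finite_setOf_linear (finite_setOf_eval_eq_zero ha1)
    (fun t => (sample ρ σ 0 0).b₂ t) (fun t => (t - 1) * (1 - (ρ : ℂ) * σ * t) ^ 2)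
  have F3 := finite_setOf_linear (Set.finite_singleton (0 : ℂ))
    (fun t => (sample ρ σ 0 0).a₂ 0 - σ * (sample ρ σ 0 0).b₂ 0) (fun t => (σ : ℂ))
  obtain ⟨B, hB0, hB⟩ := exists_pos_notMem ((F1.union F2).union F3)
  simp only [Set.mem_union, not_or] at hB
  obtain ⟨⟨h1, h2⟩, h3⟩ := hB
  refine ⟨B, hB0, ?_, ?_, ?_⟩
  · rintro A t ht0 ht1 ⟨hb2, hb1, hb0⟩
    have ht1' : t - 1 ≠ 0 := sub_ne_zero.2 ht1
    refine h1 ⟨t, ?_, ?_, ?_⟩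
    · refine mul_left_cancel₀ (mul_ne_zero hσ ht0) ?_
      simp only [hf, eval_add, eval_mul, eval_sub, eval_pow, eval_one, eval_C, eval_X, mul_zero]
      simp only [sample, b₂, b₁, b₀] at hb2 hb1 hb0
      linear_combination ((ρ : ℂ) * σ * t) ^ 2 * hb2
        - ((ρ : ℂ) * σ * t) * (1 - (ρ : ℂ) * σ * t) * hb1 + t * (1 - (ρ : ℂ) * σ * t) ^ 2 * hb0
    · simp [ht1', hρ, hσ, ht0]
    · simp only [sample, b₀] at hb0 ⊢
      linear_combination hb0
  · rintro A t ht0 ht1 ⟨ha, hb⟩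
    have ht1' : t - 1 ≠ 0 := sub_ne_zero.2 ht1
    refine h2 ⟨t, ?_, ?_, ?_⟩
    · rw [Set.mem_ofPred_eq, eval_a₂]; exact ha
    · have : 1 - (ρ : ℂ) * σ * t ≠ 0 := by
        intro h
        simp only [sample, a₂, h] at ha
        simp [hρ, hσ] at ha
        exact ht1' (by linear_combination -ha)
      simp [ht1', this]
    · simp only [sample, b₂] at hb ⊢
      linear_combination hb
  · intro A h
    refine h3 ⟨0, rfl, hσ, ?_⟩
    simp only [sample, a₂, b₂] at h ⊢
    linear_combination h

lemma exists_nondegenerate : ∃ A B : ℝ, 0 < A ∧ 0 < B ∧ (sample ρ σ A B).Nondegenerate := by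
  obtain ⟨B, hB0, hb, hab, h0⟩ := exists_good_B hρ0 hρ1 hσ0 hσ1
  have hρσ := ofReal_one_sub_mul_ne hρ0 hρ1 hσ1
  have hρ : (ρ : ℂ) ≠ 0 := by exact_mod_cast hρ0.ne'
  have hσ : (σ : ℂ) ≠ 0 := by exact_mod_cast hσ0.ne'
  have hσ1' : 1 - (σ : ℂ) ≠ 0 := by
    have : 1 - σ ≠ 0 := by linarith
    exact_mod_cast this
  -- The value `y = σ / 2` of the family keeps `y`, `x * z - y ^ 2` and the discriminant at `t = 1`
  -- nonzero for every `σ` in `(0, 1)`.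
  have hD : (1 : ℂ) * 1 - (σ / 2 : ℂ) ^ 2 ≠ 0 := by
    have : (1 : ℝ) * 1 - (σ / 2) ^ 2 ≠ 0 := by nlinarith
    exact_mod_cast this
  have hE : (1 + (σ : ℂ)) ^ 2 * (σ / 2 : ℂ) ^ 2 - 4 * σ * 1 * 1 ≠ 0 := by
    have : (1 + σ) ^ 2 * (σ / 2) ^ 2 - 4 * σ * 1 * 1 ≠ 0 := by
      have h1 : (1 + σ) ^ 2 < 4 := by nlinarith
      have h2 : (σ / 2) ^ 2 < σ := by nlinarith
      nlinarith [mul_lt_mul'' h1 h2 (by positivity) (by positivity)]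
    exact_mod_cast this
  have hM1 : ((sample ρ σ 0 B).toPoly.minor₂₁ X).eval 1 ≠ 0 := by
    rw [eval_minor₂₁, minor₂₁_one]; simp [sample, hρσ, hσ]
  -- With `B` fixed, three kinds of `A` are avoided: those with `minor₂₀ = 0` at a zero of
  -- `minor₂₁`, those whose curve `eqA = 0` meets a bad point of `eqB = 0`, and those with `elim 0 =
  -- 0`. Each condition is affine in `A`, while `minor₂₁`, `eqB` and the bad locus do not involve
  -- `A`.
  have F1 := finite_setOf_linear (finite_setOf_eval_eq_zero hM1)
    (fun t => (sample ρ σ 0 B).minor₂₀ t)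
    (fun t => (ρ : ℂ) * (σ : ℂ) ^ 2 * (1 - t) * (sample ρ σ 0 B).b₂ t)
  have F2 := finite_setOf_linear
    (finite_bad (d := sample ρ σ 0 B) hρσ hσ1' hσ one_ne_zero one_ne_zero hD hE (hb 0))
    (fun tp => (sample ρ σ 0 B).eqA tp.1 tp.2)
    (fun tp => (σ : ℂ) ^ 2 * ρ * tp.1 * (tp.1 - 1))
  have F3 := finite_setOf_linear (Set.finite_singleton (0 : ℂ))
    (fun t => σ * (sample ρ σ 0 B).b₀ 0 - (sample ρ σ 0 B).a₀ 0) (fun t => (σ : ℂ) ^ 2 * ρ)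
  obtain ⟨A, hA0, hA⟩ := exists_pos_notMem ((F1.union F2).union F3)
  simp only [Set.mem_union, not_or] at hA
  obtain ⟨⟨h1, h2⟩, h3⟩ := hA
  set d := sample ρ σ A B with hd
  have n0 : ∀ t, d.elim t = 0 → t ≠ 0 := by
    rintro t ht rfl
    rw [elim_zero, neg_eq_zero] at ht
    refine mul_ne_zero (mul_ne_zero (pow_ne_zero 2 ?_) (h0 A)) ?_ ht
    · have : σ / 2 + ρ * σ * 1 ≠ 0 := by positivity
      simp only [hd, sample]
      exact_mod_cast this
    · intro h
      refine h3 ⟨0, rfl, mul_ne_zero (pow_ne_zero 2 hσ) hρ, ?_⟩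
      simp only [hd, sample, b₀, a₀] at h ⊢
      linear_combination h
  have n1 : ∀ t, d.elim t = 0 → t ≠ 1 := by
    rintro t ht rfl
    rw [elim_one] at ht
    refine mul_ne_zero (mul_ne_zero (mul_ne_zero (mul_ne_zero (pow_ne_zero 2 hσ)
      (pow_ne_zero 6 hρσ)) one_ne_zero) one_ne_zero) hD ht
  have nM : ∀ t, d.elim t = 0 → d.minor₂₁ t ≠ 0 := by
    intro t ht hM
    have hK : d.minor₂₀ t = 0 := by
      simp only [elim, hM] at ht
      simpa [n0 t (by simp only [elim, hM]; exact ht)] using ht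
    have hM' : d.a₂ t * d.b₁ t - d.a₁ t * d.b₂ t = 0 := hM
    have hK' : d.a₂ t * d.b₀ t - d.a₀ t * d.b₂ t = 0 := hK
    have t0 := n0 t ht
    have t1 := n1 t ht
    -- If `b₂ = 0`, the vanishing minors make `eqB` identically zero in `p`, contrary to the choice
    -- of `B`; otherwise `minor₂₀` really depends on `A`.
    by_cases hb2 : d.b₂ t = 0
    · have ha2 : d.a₂ t ≠ 0 := fun h => hab A t t0 t1 ⟨h, hb2⟩
      refine hb A t t0 t1 ⟨hb2, ?_, ?_⟩
      · simpa [hb2, ha2] using hM'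
      · simpa [hb2, ha2] using hK'
    · refine h1 ⟨t, ?_, ?_, ?_⟩
      · rw [Set.mem_ofPred_eq, eval_minor₂₁]; exact hM
      · exact mul_ne_zero (mul_ne_zero (mul_ne_zero hρ (pow_ne_zero 2 hσ))
          (sub_ne_zero.2 t1.symm)) hb2
      · simp only [hd, sample, a₂, a₀, b₂, b₀, minor₂₀] at hK' ⊢
        linear_combination hK'
  have nT : ∀ t, d.elim t = 0 → d.badLocus t (d.root t) ≠ 0 := by
    intro t ht h
    have hA := d.eqA_root (nM t ht) ht
    have hB := d.eqB_root (nM t ht) ht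
    have t0 := n0 t ht
    have t1 := n1 t ht
    refine h2 ⟨(t, d.root t), ⟨t0, t1, hB, ?_⟩, ?_, ?_⟩
    · simp only [badLocus] at h ⊢
      rw [hd, sample, redJacobian_congr _ _ _ _ _ _ _ 0] at h
      exact h
    · exact mul_ne_zero (mul_ne_zero (mul_ne_zero (pow_ne_zero 2 hσ) hρ) t0) (sub_ne_zero.2 t1)
    · simp only [eqA, eqA₀, slope] at hA ⊢
      generalize d.root t = p at hA ⊢
      simp only [hd, sample] at hA ⊢
      linear_combination hA
  refine ⟨A, B, hA0, hB0, one_ne_zero, ?_, ?_, ?_, n0, fun t ht => sub_ne_zero.2 (n1 t ht).symm, nM,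
    ?_, ?_, ?_⟩
  · have : σ / 2 + ρ * σ * 1 ≠ 0 := by positivity
    simp only [sample]
    exact_mod_cast this
  · simp only [sample]
    exact_mod_cast hA0.ne'
  · simp only [sample]
    exact_mod_cast hB0.ne'
  · intro t ht
    rw [slopeNum_eq _ (nM t ht)]
    exact mul_ne_zero (nM t ht) (left_ne_zero_of_mul (left_ne_zero_of_mul (nT t ht)))
  · intro t ht
    rw [covNum_eq _ (nM t ht)]
    exact mul_ne_zero (pow_ne_zero 2 (nM t ht))
      (right_ne_zero_of_mul (left_ne_zero_of_mul (nT t ht)))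
  · intro t ht
    have hA := d.eqA_root (nM t ht) ht
    have hB := d.eqB_root (nM t ht) ht
    refine right_ne_zero_of_mul (a := t) ?_
    rw [d.derivative_elim hA hB ht]
    refine mul_ne_zero (nM t ht) (right_ne_zero_of_mul (a := t * (1 - t)) ?_)
    have := right_ne_zero_of_mul (nT t ht)
    simpa [redJacobian, hA] using this

end

/-! ### Nine simple roots, and genericity of nondegeneracy -/

lemma Nondegenerate.encard_roots {d : Stats ℂ} (hd : d.Nondegenerate) (hρ : d.ρ ≠ 0)
    (hσ : d.σ ≠ 0) : {t | d.elim t = 0}.encard = 9 := by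
  obtain ⟨h1, h2⟩ := d.elim_degree_coeff
  have h3 : (d.toPoly.elim X).coeff 9 ≠ 0 := by
    rw [h2]
    exact mul_ne_zero (mul_ne_zero (pow_ne_zero _ hρ) (pow_ne_zero _ hσ))
      (pow_ne_zero _ (mul_ne_zero hd.A_ne hd.B_ne))
  have h4 : (d.toPoly.elim X).natDegree = 9 := le_antisymm h1 (le_natDegree_of_ne_zero h3)
  have h5 : d.toPoly.elim X ≠ 0 := by
    intro h; rw [h] at h3; simp at h3
  have h6 : (d.toPoly.elim X).roots.Nodup := by
    refine nodup_roots (separable_def _ |>.2 ?_)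
    refine isCoprime_of_irreducible_dvd (fun h => h5 h.1) ?_
    intro z hz hz1 hz2
    obtain ⟨t, ht⟩ := IsAlgClosed.exists_root z (by
      have := hz.degree_pos; exact this.ne')
    have e1 := ht.dvd hz1
    have e2 := ht.dvd hz2
    rw [IsRoot.def, eval_elim] at e1
    exact hd.deriv_ne t e1 e2
  have h7 : {t | d.elim t = 0} = ((d.toPoly.elim X).roots.toFinset : Set ℂ) := by
    ext t
    simp [h5, eval_elim]
  rw [h7, Set.encard_coe_eq_coe_finsetCard, Multiset.toFinset_card_of_nodup h6,
    IsAlgClosed.card_roots_eq_natDegree, h4]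
  rfl

/-- All conditions at roots of `elim` say that `elim` has no common root with one product
polynomial. Their resultant lies in `D`, so for `D` a ring of data polynomials it is the polynomial
sought, up to four explicit factors. -/
lemma exists_nondegenerate_locus {D : Type*} [CommRing D] (d : Stats D) (φ : D →+* ℂ)
    (hφ : (d.map φ).Nondegenerate) (hρ : φ d.ρ ≠ 0) (hσ : φ d.σ ≠ 0) :
    ∃ F : D, φ F ≠ 0 ∧ ∀ ψ : D →+* ℂ, ψ F ≠ 0 → (d.map ψ).Nondegenerate := by
  have poly (ψ : D →+* ℂ) : d.toPoly.map (Polynomial.map ψ) = (d.map ψ).toPoly := d.toPoly_map ψ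
  have hf (ψ : D →+* ℂ) : (d.toPoly.elim X).map ψ = (d.map ψ).toPoly.elim X := by
    simpa [poly] using map_elim (mapRingHom ψ) d.toPoly X
  have hg₁ (ψ : D →+* ℂ) : (d.toPoly.minor₂₁ X).map ψ = (d.map ψ).toPoly.minor₂₁ X := by
    simpa [poly] using map_minor₂₁ (mapRingHom ψ) d.toPoly X
  have hg₂ (ψ : D →+* ℂ) : (d.toPoly.slopeNum X).map ψ = (d.map ψ).toPoly.slopeNum X := by
    simpa [poly] using map_slopeNum (mapRingHom ψ) d.toPoly X
  have hg₃ (ψ : D →+* ℂ) : (d.toPoly.covNum X).map ψ = (d.map ψ).toPoly.covNum X := by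
    simpa [poly] using map_covNum (mapRingHom ψ) d.toPoly X
  have hg (ψ : D →+* ℂ) (t : ℂ) : ((derivative (d.toPoly.elim X) * X * (1 - X) *
      d.toPoly.minor₂₁ X * d.toPoly.slopeNum X * d.toPoly.covNum X).map ψ).eval t =
      (derivative ((d.map ψ).toPoly.elim X)).eval t * t * (1 - t) * (d.map ψ).minor₂₁ t
        * (d.map ψ).slopeNum t * (d.map ψ).covNum t := by
    simp only [Polynomial.map_mul, Polynomial.map_sub, Polynomial.map_one, map_X, hg₁, hg₂, hg₃,
      ← derivative_map, hf, eval_mul, eval_sub, eval_one, eval_X, eval_minor₂₁, eval_slopeNum,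
      eval_covNum]
  obtain ⟨q, hq, hq'⟩ := exists_ne_zero_of_no_common_root φ (d.toPoly.elim X)
    (derivative (d.toPoly.elim X) * X * (1 - X) *
      d.toPoly.minor₂₁ X * d.toPoly.slopeNum X * d.toPoly.covNum X) (m := 9) (by norm_num)
    d.elim_degree_coeff.1
    (by
      rw [d.elim_degree_coeff.2]
      simp only [_root_.map_mul, _root_.map_pow]
      exact mul_ne_zero (mul_ne_zero (pow_ne_zero _ hρ) (pow_ne_zero _ hσ))
        (pow_ne_zero _ (mul_ne_zero hφ.A_ne hφ.B_ne)))
    (fun t ht => by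
      rw [hf, eval_elim] at ht
      rw [hg]
      exact mul_ne_zero (mul_ne_zero (mul_ne_zero (mul_ne_zero (mul_ne_zero (hφ.deriv_ne t ht)
        (hφ.ne_zero t ht)) (hφ.ne_one t ht)) (hφ.minor_ne t ht)) (hφ.slope_ne t ht))
        (hφ.cov_ne t ht))
  refine ⟨d.κ * (d.y + d.ρ * d.σ * d.κ) * d.A * d.B * q, ?_, fun ψ hψ => ?_⟩
  · simp only [_root_.map_mul, _root_.map_add]
    exact mul_ne_zero (mul_ne_zero (mul_ne_zero (mul_ne_zero hφ.κ_ne hφ.y_ne) hφ.A_ne) hφ.B_ne) hq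
  · simp only [_root_.map_mul, _root_.map_add, mul_ne_zero_iff] at hψ
    obtain ⟨⟨⟨⟨h1, h2⟩, h3⟩, h4⟩, h5⟩ := hψ
    have key (t : ℂ) (ht : (d.map ψ).elim t = 0) := by
      have := mt (hq' ψ t (by rw [hf, eval_elim]; exact ht)) h5
      rw [hg] at this
      simp only [mul_ne_zero_iff] at this
      exact this
    exact ⟨h1, h2, h3, h4, fun t ht => (key t ht).1.1.1.1.2, fun t ht => (key t ht).1.1.1.2,
      fun t ht => (key t ht).1.1.2, fun t ht => (key t ht).1.2, fun t ht => (key t ht).2,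
      fun t ht => (key t ht).1.1.1.1.1⟩

end Stats

/-! ### Algebraic reduction of the score equations -/

section algebra

variable {F : Type*} [Field F]

/-- The score equations in the coordinates `u = σ₁₂ / σ₁₁`, `v = σ₁₂ / σ₂₂` and
`ω = (1 - u * v) * σ₁₂`. -/
lemma score_iff [CharZero F] (n r s Y₁ Y₂ Y₁₁ Y₁₂ Y₂₂ Z ZZ W WW m₁ m₂ : F) {u v ω : F} (hu : u ≠ 0) (hv : v ≠ 0)
    (hω : ω ≠ 0) (ht : 1 - u * v ≠ 0) {g₁₁ g₁₂ g₂₂ D : F} (hg₁₁ : g₁₁ = u / ω)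
    (hg₁₂ : g₁₂ = -(u * v) / ω) (hg₂₂ : g₂₂ = v / ω) (hD : D = u * v * (1 - u * v) / ω ^ 2) :
    (n * ((Y₁ - m₁) * g₁₁ + (Y₂ - m₂) * g₁₂) + r * (D / g₂₂) * (Z - m₁) = 0 ∧
    n * ((Y₂ - m₂) * g₂₂ + (Y₁ - m₁) * g₁₂) + s * (D / g₁₁) * (W - m₂) = 0 ∧
    1 / 2 * (n + r + s) * (g₂₂ / D) - 1 / 2 * (s / g₁₁) - n / 2 * (Y₁₁ - 2 * m₁ * Y₁ + m₁ ^ 2)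
      - r / 2 * (ZZ - 2 * m₁ * Z + m₁ ^ 2)
      - s / 2 * (g₁₂ ^ 2 / g₁₁ ^ 2) * (WW - 2 * m₂ * W + m₂ ^ 2) = 0 ∧
    1 / 2 * (n + r + s) * (g₁₁ / D) - 1 / 2 * (r / g₂₂) - n / 2 * (Y₂₂ - 2 * m₂ * Y₂ + m₂ ^ 2)
      - s / 2 * (WW - 2 * m₂ * W + m₂ ^ 2)
      - r / 2 * (g₁₂ ^ 2 / g₂₂ ^ 2) * (ZZ - 2 * m₁ * Z + m₁ ^ 2) = 0 ∧
    -((n + r + s) * (g₁₂ / D)) - n * (Y₁₂ - (Y₁ * m₂ + Y₂ * m₁) + m₁ * m₂)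
      + r * (g₁₂ / g₂₂) * (ZZ - 2 * m₁ * Z + m₁ ^ 2)
      + s * (g₁₂ / g₁₁) * (WW - 2 * m₂ * W + m₂ ^ 2) = 0) ↔
    (n * ((Y₁ - m₁) - v * (Y₂ - m₂)) + r * (1 - u * v) * (Z - m₁) = 0 ∧
    n * ((Y₂ - m₂) - u * (Y₁ - m₁)) + s * (1 - u * v) * (W - m₂) = 0 ∧
    (n + r + s * (u * v)) * ω - u * (1 - u * v) * (n * (Y₁₁ - 2 * m₁ * Y₁ + m₁ ^ 2)
      + r * (ZZ - 2 * m₁ * Z + m₁ ^ 2) + s * v ^ 2 * (WW - 2 * m₂ * W + m₂ ^ 2)) = 0 ∧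
    (n + s + r * (u * v)) * ω - v * (1 - u * v) * (n * (Y₂₂ - 2 * m₂ * Y₂ + m₂ ^ 2)
      + s * (WW - 2 * m₂ * W + m₂ ^ 2) + r * u ^ 2 * (ZZ - 2 * m₁ * Z + m₁ ^ 2)) = 0 ∧
    (n + r + s) * ω - (1 - u * v) * (n * (Y₁₂ - (Y₁ * m₂ + Y₂ * m₁) + m₁ * m₂)
      + r * u * (ZZ - 2 * m₁ * Z + m₁ ^ 2) + s * v * (WW - 2 * m₂ * W + m₂ ^ 2)) = 0) := by
  have h2 : (2 : F) ≠ 0 := two_ne_zero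
  have ht' : 1 - v * u ≠ 0 := by rwa [mul_comm]
  have r1 : D / g₂₂ = u * (1 - u * v) / ω := by rw [hD, hg₂₂]; field_simp
  have r2 : D / g₁₁ = v * (1 - u * v) / ω := by rw [hD, hg₁₁]; field_simp
  have r3 : g₂₂ / D = ω / (u * (1 - u * v)) := by rw [hD, hg₂₂]; field_simp
  have r4 : g₁₁ / D = ω / (v * (1 - u * v)) := by rw [hD, hg₁₁]; field_simp
  have r5 : g₁₂ / D = -(ω / (1 - u * v)) := by rw [hD, hg₁₂]; field_simp
  have r6 : g₁₂ / g₂₂ = -u := by rw [hg₁₂, hg₂₂]; field_simp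
  have r7 : g₁₂ / g₁₁ = -v := by rw [hg₁₂, hg₁₁]; field_simp
  have r8 : g₁₂ ^ 2 / g₂₂ ^ 2 = u ^ 2 := by rw [← div_pow, r6, neg_sq]
  have r9 : g₁₂ ^ 2 / g₁₁ ^ 2 = v ^ 2 := by rw [← div_pow, r7, neg_sq]
  rw [r1, r2, r3, r4, r5, r6, r7, r8, r9, hg₁₁, hg₁₂, hg₂₂]
  generalize ZZ - 2 * m₁ * Z + m₁ ^ 2 = A
  generalize WW - 2 * m₂ * W + m₂ ^ 2 = B
  generalize Y₁₁ - 2 * m₁ * Y₁ + m₁ ^ 2 = S₁₁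
  generalize Y₂₂ - 2 * m₂ * Y₂ + m₂ ^ 2 = S₂₂
  generalize Y₁₂ - (Y₁ * m₂ + Y₂ * m₁) + m₁ * m₂ = S₁₂
  generalize Y₁ - m₁ = E₁
  generalize Y₂ - m₂ = E₂
  have unit {x y c : F} (hc : c ≠ 0) (h : x = c * y) : x = 0 ↔ y = 0 := by
    rw [h, mul_eq_zero, or_iff_right hc]
  refine and_congr (unit (c := u / ω) (div_ne_zero hu hω) ?_)
    (and_congr (unit (c := v / ω) (div_ne_zero hv hω) ?_)
    (and_congr (unit (c := (2 * u * (1 - u * v))⁻¹) ?_ ?_)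
    (and_congr (unit (c := (2 * v * (1 - u * v))⁻¹) ?_ ?_)
    (unit (c := (1 - u * v)⁻¹) (inv_ne_zero ht) ?_))))
  · field_simp; ring
  · field_simp; ring
  · exact inv_ne_zero (mul_ne_zero (mul_ne_zero h2 hu) ht)
  · field_simp; ring
  · exact inv_ne_zero (mul_ne_zero (mul_ne_zero h2 hv) ht)
  · field_simp; ring
  · field_simp; ring

/-- Elimination of the variances from the score equations. -/
lemma reduced_iff {n r s ρ σ p q α β S₁₁ S₁₂ S₂₂ A B : F} {u v ω : F} (hn : n ≠ 0)
    (hN : n + r + s ≠ 0) (hr : n + r ≠ 0) (hs : n + s ≠ 0)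
    (hρ : ρ = r / (n + r)) (hσ : σ = s / (n + s)) (ht : 1 - u * v ≠ 0) :
    (n * ((p - α) - v * (q - β)) + r * (1 - u * v) * p = 0 ∧
    n * ((q - β) - u * (p - α)) + s * (1 - u * v) * q = 0 ∧
    (n + r + s * (u * v)) * ω - u * (1 - u * v) * (n * S₁₁ + r * A + s * v ^ 2 * B) = 0 ∧
    (n + s + r * (u * v)) * ω - v * (1 - u * v) * (n * S₂₂ + s * B + r * u ^ 2 * A) = 0 ∧
    (n + r + s) * ω - (1 - u * v) * (n * S₁₂ + r * u * A + s * v * B) = 0) ↔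
    (p / (1 - ρ) + σ * v * (q / (1 - σ)) = α ∧ q / (1 - σ) + ρ * u * (p / (1 - ρ)) = β ∧
    ω = u * S₁₁ + v * S₂₂ - (1 + u * v) * S₁₂ ∧
    v * S₂₂ + ρ * u * S₁₁ - (1 + ρ * (u * v)) * S₁₂ - ρ * (1 - u * v) * u * A = 0 ∧
    u * S₁₁ + σ * v * S₂₂ - (1 + σ * (u * v)) * S₁₂ - σ * (1 - u * v) * v * B = 0) := by
  have hρ1 : 1 - ρ = n / (n + r) := by rw [hρ]; field_simp; ring
  have hσ1 : 1 - σ = n / (n + s) := by rw [hσ]; field_simp; ring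
  have a1 : p / (1 - ρ) + σ * v * (q / (1 - σ)) = ((n + r) * p + s * v * q) / n := by
    rw [hρ1, hσ1, hσ]; field_simp
  have a2 : q / (1 - σ) + ρ * u * (p / (1 - ρ)) = ((n + s) * q + r * u * p) / n := by
    rw [hρ1, hσ1, hρ]; field_simp
  have a3 : v * S₂₂ + ρ * u * S₁₁ - (1 + ρ * (u * v)) * S₁₂ - ρ * (1 - u * v) * u * A
      = ((n + r) * (v * S₂₂ - S₁₂) + r * (u * S₁₁ - u * v * S₁₂ - (1 - u * v) * u * A))
        / (n + r) := by
    rw [hρ]; field_simp; ring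
  have a4 : u * S₁₁ + σ * v * S₂₂ - (1 + σ * (u * v)) * S₁₂ - σ * (1 - u * v) * v * B
      = ((n + s) * (u * S₁₁ - S₁₂) + s * (v * S₂₂ - u * v * S₁₂ - (1 - u * v) * v * B))
        / (n + s) := by
    rw [hσ]; field_simp; ring
  rw [a1, a2, a3, a4, div_eq_iff hn, div_eq_iff hn, div_eq_zero_iff, div_eq_zero_iff,
    or_iff_left hr, or_iff_left hs]
  clear a1 a2 a3 a4 hρ hσ hρ1 hσ1
  constructor
  · rintro ⟨h1, h2, h3, h4, h5⟩
    refine ⟨?_, ?_, ?_, ?_, ?_⟩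
    -- The two mean equations are decoupled by a matrix of determinant `1 - u * v`.
    · refine mul_left_cancel₀ ht ?_; linear_combination h1 + v * h2
    · refine mul_left_cancel₀ ht ?_; linear_combination h2 + u * h1
    -- In this combination `A` and `B` cancel, so `ω` depends on the complete-sample moments only;
    -- the next two combinations cancel `ω` instead.
    · refine mul_left_cancel₀ (mul_ne_zero hn ht) ?_
      linear_combination h3 + h4 - (1 + u * v) * h5
    · refine mul_left_cancel₀ (mul_ne_zero (mul_ne_zero hn hN) ht) ?_
      linear_combination -(n + r) * ((n + r + s) * h4 - (n + s + r * (u * v)) * h5)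
        - r * ((n + r + s) * h3 - (n + r + s * (u * v)) * h5)
    · refine mul_left_cancel₀ (mul_ne_zero (mul_ne_zero hn hN) ht) ?_
      linear_combination -(n + s) * ((n + r + s) * h3 - (n + r + s * (u * v)) * h5)
        - s * ((n + r + s) * h4 - (n + s + r * (u * v)) * h5)
  · rintro ⟨h1, h2, h3, h4, h5⟩
    refine ⟨?_, ?_, ?_, ?_, ?_⟩
    · linear_combination h1 - v * h2
    · linear_combination h2 - u * h1
    · linear_combination (n + r + s * (u * v)) * h3 + u * v * h5 + h4
    · linear_combination (n + s + r * (u * v)) * h3 + u * v * h4 + h5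
    · linear_combination (n + r + s) * h3 + h4 + h5

end algebra

/-! ### Statistics of the data and the reduced score equations -/

/-- The average, over an arbitrary real algebra. -/
noncomputable def mean {K : Type*} [CommRing K] [Algebra ℝ K] {k : ℕ} (f : Fin k → K) : K :=
  algebraMap ℝ K (k : ℝ)⁻¹ * ∑ j, f j

lemma average_eq_mean {k : ℕ} (f : Fin k → ℂ) : average f = mean f := by
  simp [average, mean, div_eq_inv_mul]

section dataStats

variable {K : Type*} [CommRing K] [Algebra ℝ K] {n r s : ℕ} (y : Fin n → Fin 2 → K)
  (z : Fin r → K) (w : Fin s → K)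

noncomputable def shift₁ : K := mean z - mean fun j => y j 0

noncomputable def shift₂ : K := mean w - mean fun j => y j 1

/-- The normalized sufficient statistics of the data. -/
noncomputable def dataStats : Stats K where
  ρ := algebraMap ℝ K (r / (n + r))
  σ := algebraMap ℝ K (s / (n + s))
  κ := shift₁ y z ^ 2 * shift₂ y w ^ 2
  x := (mean (fun j => y j 0 ^ 2) - mean (fun j => y j 0) ^ 2) * shift₂ y w ^ 2
  y := (mean (fun j => y j 0 * y j 1) - mean (fun j => y j 0) * mean fun j => y j 1)
    * (shift₁ y z * shift₂ y w)
  z := (mean (fun j => y j 1 ^ 2) - mean (fun j => y j 1) ^ 2) * shift₁ y z ^ 2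
  A := (mean (fun j => z j ^ 2) - mean z ^ 2) * shift₂ y w ^ 2
  B := (mean (fun j => w j ^ 2) - mean w ^ 2) * shift₁ y z ^ 2

lemma map_mean {L : Type*} [CommRing L] [Algebra ℝ L] (ψ : K →ₐ[ℝ] L) {k : ℕ} (f : Fin k → K) :
    ψ (mean f) = mean fun j => ψ (f j) := by
  simp [mean]

lemma map_dataStats {L : Type*} [CommRing L] [Algebra ℝ L] (ψ : K →ₐ[ℝ] L) :
    (dataStats y z w).map ψ = dataStats (fun j i => ψ (y j i)) (fun j => ψ (z j))
      (fun j => ψ (w j)) := by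
  simp [dataStats, Stats.map, map_mean, shift₁, shift₂]

end dataStats

namespace Stats

section

variable {F : Type*} [Field F] {d : Stats F} {α β s₁₁ s₁₂ s₂₂ zz ww H K u v : F} (hα : α ≠ 0)
  (h₁ : H + d.σ * v * K = α) (h₂ : K + d.ρ * u * H = β)
include hα h₁ h₂

/-- By `h₁`, `1 - p = H / α` for `p = σ v K / α`; multiplying `h₂` by `σ v / α` gives the slope. -/
lemma slope_eq : d.slope (u * v) (d.σ * v * K / α) = d.σ * v * β / α := by
  simp only [slope]
  field_simp
  rw [← h₁, ← h₂]
  ring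

variable (hκ : d.κ = α ^ 2 * β ^ 2) (hy : d.y = s₁₂ * (α * β)) (hz : d.z = s₂₂ * α ^ 2)
  (hx : d.x = s₁₁ * β ^ 2)
include hκ hy hz hx

lemma cov_eq : d.cov (u * v) (d.σ * v * K / α) = d.σ ^ 2 * β ^ 2 * v *
    (u * (s₁₁ + (d.ρ * H + d.σ * v * K) ^ 2) + v * (s₂₂ + (d.σ * K + d.ρ * u * H) ^ 2)
      - (1 + u * v) * (s₁₂ + (d.ρ * H + d.σ * v * K) * (d.σ * K + d.ρ * u * H))) := by
  simp only [cov, slope_eq hα h₁ h₂, hκ, hy, hz, hx]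
  field_simp
  rw [← h₁, ← h₂]
  ring

/-- This identifies `eqA` with a score equation from `reduced_iff`, up to a factor that is a unit at
the points considered; `eqB_eq_score` does the same for `eqB`. -/
lemma eqA_eq_score (hA : d.A = zz * β ^ 2) :
    d.eqA (u * v) (d.σ * v * K / α) = d.σ ^ 2 * β ^ 2 * v *
    (v * (s₂₂ + (d.σ * K + d.ρ * u * H) ^ 2) + d.ρ * u * (s₁₁ + (d.ρ * H + d.σ * v * K) ^ 2)
      - (1 + d.ρ * (u * v)) * (s₁₂ + (d.ρ * H + d.σ * v * K) * (d.σ * K + d.ρ * u * H))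
      - d.ρ * (1 - u * v) * u * (zz + ((1 - d.ρ) * H) ^ 2)) := by
  simp only [eqA, eqA₀, slope_eq hα h₁ h₂, hκ, hy, hz, hx, hA]
  field_simp
  rw [← h₁, ← h₂]
  ring

lemma eqB_eq_score (hB : d.B = ww * α ^ 2) :
    d.eqB (u * v) (d.σ * v * K / α) = d.σ * β ^ 2 * v *
    (u * (s₁₁ + (d.ρ * H + d.σ * v * K) ^ 2) + d.σ * v * (s₂₂ + (d.σ * K + d.ρ * u * H) ^ 2)
      - (1 + d.σ * (u * v)) * (s₁₂ + (d.ρ * H + d.σ * v * K) * (d.σ * K + d.ρ * u * H))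
      - d.σ * (1 - u * v) * v * (ww + ((1 - d.σ) * K) ^ 2)) := by
  simp only [eqB, slope_eq hα h₁ h₂, hκ, hy, hz, hx, hB]
  field_simp
  rw [← h₁, ← h₂]
  ring

end

end Stats

open Stats

/-- The parameter vector with regression coefficients `u`, `v` and means expressed by `H`, `K`. -/
noncomputable def paramOf (Z W ρ σ u v H K ω : ℂ) : Params ℂ :=
  (![Z - (1 - ρ) * H, W - (1 - σ) * K], ![u / ω, -(u * v) / ω, v / ω])

section

variable {n r s : ℕ} (y : Fin n → Fin 2 → ℂ) (z : Fin r → ℂ) (w : Fin s → ℂ)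

/-- The covariance factor `(1 - u * v) * σ₁₂` at given regression coefficients. -/
noncomputable def covOf (u v H K : ℂ) : ℂ :=
  u * (mean (fun j => y j 0 ^ 2) - mean (fun j => y j 0) ^ 2
      + ((dataStats y z w).ρ * H + (dataStats y z w).σ * v * K) ^ 2)
    + v * (mean (fun j => y j 1 ^ 2) - mean (fun j => y j 1) ^ 2
      + ((dataStats y z w).σ * K + (dataStats y z w).ρ * u * H) ^ 2)
    - (1 + u * v) * (mean (fun j => y j 0 * y j 1) - mean (fun j => y j 0) * mean (fun j => y j 1)
      + ((dataStats y z w).ρ * H + (dataStats y z w).σ * v * K)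
        * ((dataStats y z w).σ * K + (dataStats y z w).ρ * u * H))

lemma isCriticalPoint_paramOf_iff (hn : 0 < n) (hr : 0 < r) (hs : 0 < s) {u v H K ω : ℂ}
    (hα : shift₁ y z ≠ 0) (hβ : shift₂ y w ≠ 0)
    (hu : u ≠ 0) (hv : v ≠ 0) (hω : ω ≠ 0) (ht : 1 - u * v ≠ 0) :
    IsCriticalPoint y z w
      (paramOf (mean z) (mean w) (dataStats y z w).ρ (dataStats y z w).σ u v H K ω) ↔
    H + (dataStats y z w).σ * v * K = shift₁ y z ∧ K + (dataStats y z w).ρ * u * H = shift₂ y w ∧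
    ω = covOf y z w u v H K ∧
    (dataStats y z w).eqA (u * v) ((dataStats y z w).σ * v * K / shift₁ y z) = 0 ∧
    (dataStats y z w).eqB (u * v) ((dataStats y z w).σ * v * K / shift₁ y z) = 0 := by
  set d := dataStats y z w with hd
  have cn : (n : ℂ) ≠ 0 := by exact_mod_cast hn.ne'
  have cnr : (n : ℂ) + r ≠ 0 := by exact_mod_cast (by omega : n + r ≠ 0)
  have cns : (n : ℂ) + s ≠ 0 := by exact_mod_cast (by omega : n + s ≠ 0)
  have cr : (r : ℂ) ≠ 0 := by exact_mod_cast hr.ne'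
  have cs : (s : ℂ) ≠ 0 := by exact_mod_cast hs.ne'
  have cN : (n : ℂ) + r + s ≠ 0 := by exact_mod_cast (by omega : n + r + s ≠ 0)
  have hρ : d.ρ = r / (n + r) := by simp [hd, dataStats]
  have hσ : d.σ = s / (n + s) := by simp [hd, dataStats]
  have hρ1 : 1 - d.ρ ≠ 0 := by
    have : 1 - d.ρ = n / (n + r) := by rw [hρ]; field_simp; ring
    rw [this]; exact div_ne_zero cn cnr
  have hσ1 : 1 - d.σ ≠ 0 := by
    have : 1 - d.σ = n / (n + s) := by rw [hσ]; field_simp; ring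
    rw [this]; exact div_ne_zero cn cns
  have hσ0 : d.σ ≠ 0 := by rw [hσ]; exact div_ne_zero cs cns
  have hdet : (concentration (paramOf (mean z) (mean w) d.ρ d.σ u v H K ω)).det
      = u * v * (1 - u * v) / ω ^ 2 := by
    simp only [concentration, paramOf, Matrix.det_fin_two_of]
    simp
    field_simp
  have hD : u * v * (1 - u * v) / ω ^ 2 ≠ 0 :=
    div_ne_zero (mul_ne_zero (mul_ne_zero hu hv) ht) (pow_ne_zero 2 hω)
  have e1 := score_iff (n : ℂ) r s (mean fun j => y j 0) (mean fun j => y j 1)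
    (mean fun j => y j 0 ^ 2) (mean fun j => y j 0 * y j 1) (mean fun j => y j 1 ^ 2) (mean z)
    (mean fun j => z j ^ 2) (mean w) (mean fun j => w j ^ 2) (mean z - (1 - d.ρ) * H)
    (mean w - (1 - d.σ) * K) hu hv hω ht rfl rfl rfl rfl
  have e2 := reduced_iff (n := (n : ℂ)) (r := r) (s := s) (ρ := d.ρ) (σ := d.σ)
    (p := (1 - d.ρ) * H) (q := (1 - d.σ) * K) (α := shift₁ y z) (β := shift₂ y w) (u := u) (v := v)
    (S₁₁ := mean (fun j => y j 0 ^ 2) - mean (fun j => y j 0) ^ 2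
      + ((1 - d.ρ) * H - shift₁ y z) ^ 2)
    (S₁₂ := mean (fun j => y j 0 * y j 1) - mean (fun j => y j 0) * mean (fun j => y j 1)
      + ((1 - d.ρ) * H - shift₁ y z) * ((1 - d.σ) * K - shift₂ y w))
    (S₂₂ := mean (fun j => y j 1 ^ 2) - mean (fun j => y j 1) ^ 2
      + ((1 - d.σ) * K - shift₂ y w) ^ 2)
    (A := mean (fun j => z j ^ 2) - mean z ^ 2 + ((1 - d.ρ) * H) ^ 2)
    (B := mean (fun j => w j ^ 2) - mean w ^ 2 + ((1 - d.σ) * K) ^ 2) (ω := ω)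
    cn cN cnr cns hρ hσ ht
  rw [mul_div_cancel_left₀ _ hρ1, mul_div_cancel_left₀ _ hσ1] at e2
  simp only [IsCriticalPoint, average_eq_mean]
  rw [hdet]
  simp only [paramOf, Matrix.cons_val_zero, Matrix.cons_val_one, Matrix.cons_val]
  rw [and_iff_right (div_ne_zero hu hω), and_iff_right (div_ne_zero hv hω), and_iff_right hD]
  refine e1.trans ?_
  clear e1
  refine Iff.trans (Iff.of_eq ?_) (e2.trans ?_)
  · simp only [shift₁, shift₂]
    congr 1
    · congr 1; ring
    congr 1
    · congr 1; ring
    congr 1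
    · congr 1; ring
    congr 1
    · congr 1; ring
    · congr 1; ring
  · refine and_congr_right fun h₁ => and_congr_right fun h₂ => ?_
    -- The residual of the complete-sample mean, `Y₁ - μ₁`, rewritten by the first linear relation.
    have f1 : (1 - d.ρ) * H - shift₁ y z = -(d.ρ * H + d.σ * v * K) := by rw [← h₁]; ring
    have f2 : (1 - d.σ) * K - shift₂ y w = -(d.σ * K + d.ρ * u * H) := by rw [← h₂]; ring
    rw [f1, f2, neg_sq, neg_sq, neg_mul_neg]
    refine and_congr Iff.rfl (and_congr ?_ ?_)
    · rw [eqA_eq_score hα h₁ h₂ rfl rfl rfl rfl rfl, mul_eq_zero, or_iff_right]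
      exact mul_ne_zero (mul_ne_zero (pow_ne_zero 2 hσ0) (pow_ne_zero 2 hβ)) hv
    · rw [eqB_eq_score hα h₁ h₂ rfl rfl rfl rfl rfl, mul_eq_zero, or_iff_right]
      exact mul_ne_zero (mul_ne_zero hσ0 (pow_ne_zero 2 hβ)) hv

end

/-! ### Critical points correspond to roots of the eliminant -/

section

variable {n r s : ℕ} (y : Fin n → Fin 2 → ℂ) (z : Fin r → ℂ) (w : Fin s → ℂ)

/-- The regression coefficient `v` above a root `t` of the eliminant. -/
noncomputable def coefOf (t : ℂ) : ℂ :=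
  shift₁ y z * (dataStats y z w).slope t ((dataStats y z w).root t)
    / ((dataStats y z w).σ * shift₂ y w)

noncomputable def coefH (t : ℂ) : ℂ := shift₁ y z * (1 - (dataStats y z w).root t)

noncomputable def coefK (t : ℂ) : ℂ :=
  shift₂ y w - (dataStats y z w).ρ * (t / coefOf y z w t) * coefH y z w t

/-- The critical point above a root `t` of the eliminant. -/
noncomputable def critOf (t : ℂ) : Params ℂ :=
  paramOf (mean z) (mean w) (dataStats y z w).ρ (dataStats y z w).σ (t / coefOf y z w t)
    (coefOf y z w t) (coefH y z w t) (coefK y z w t)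
    (covOf y z w (t / coefOf y z w t) (coefOf y z w t) (coefH y z w t) (coefK y z w t))

lemma setOf_isCriticalPoint_eq (hn : 0 < n) (hr : 0 < r) (hs : 0 < s)
    (hd : (dataStats y z w).Nondegenerate) :
    {θ | IsCriticalPoint y z w θ} = critOf y z w '' {t | (dataStats y z w).elim t = 0} ∧
    Set.InjOn (critOf y z w) {t | (dataStats y z w).elim t = 0} := by
  have cn : (n : ℂ) ≠ 0 := by exact_mod_cast hn.ne'
  have cnr : (n : ℂ) + r ≠ 0 := by exact_mod_cast (by omega : n + r ≠ 0)
  have cns : (n : ℂ) + s ≠ 0 := by exact_mod_cast (by omega : n + s ≠ 0)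
  have cs : (s : ℂ) ≠ 0 := by exact_mod_cast hs.ne'
  have hρ : (dataStats y z w).ρ = r / (n + r) := by simp [dataStats]
  have hσ : (dataStats y z w).σ = s / (n + s) := by simp [dataStats]
  have hρ1 : 1 - (dataStats y z w).ρ = n / (n + r) := by rw [hρ]; field_simp; ring
  have hσ1 : 1 - (dataStats y z w).σ = n / (n + s) := by rw [hσ]; field_simp; ring
  have hσ0 : (dataStats y z w).σ ≠ 0 := by rw [hσ]; exact div_ne_zero cs cns
  have hκ := hd.κ_ne
  have hα : shift₁ y z ≠ 0 := fun h => hκ (by simp [dataStats, h])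
  have hβ : shift₂ y w ≠ 0 := fun h => hκ (by simp [dataStats, h])
  have nv : ∀ t, (dataStats y z w).elim t = 0 → coefOf y z w t ≠ 0 := by
    intro t ht
    have h1 := hd.slope_ne t ht
    rw [slopeNum_eq _ (hd.minor_ne t ht)] at h1
    exact div_ne_zero (mul_ne_zero hα (right_ne_zero_of_mul h1)) (mul_ne_zero hσ0 hβ)
  have mp1 : ∀ t, (dataStats y z w).elim t = 0 →
      coefH y z w t + (dataStats y z w).σ * coefOf y z w t * coefK y z w t = shift₁ y z := by
    intro t ht
    have hv := nv t ht
    have e : (dataStats y z w).σ * coefOf y z w t * shift₂ y w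
        = shift₁ y z * (dataStats y z w).slope t ((dataStats y z w).root t) := by
      rw [coefOf]; field_simp
    have : (dataStats y z w).σ * coefOf y z w t * coefK y z w t
        = (dataStats y z w).σ * coefOf y z w t * shift₂ y w
          - (dataStats y z w).σ * (dataStats y z w).ρ * t * coefH y z w t := by
      rw [coefK]; field_simp
    rw [this, e, coefH]
    simp only [Stats.slope]
    ring
  have mp2 : ∀ t, coefK y z w t
      + (dataStats y z w).ρ * (t / coefOf y z w t) * coefH y z w t = shift₂ y w := by
    intro t; rw [coefK]; ring
  have hroot : ∀ t, (dataStats y z w).elim t = 0 →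
      (dataStats y z w).σ * coefOf y z w t * coefK y z w t / shift₁ y z
        = (dataStats y z w).root t := by
    intro t ht
    rw [div_eq_iff hα]
    have := mp1 t ht
    rw [coefH] at this
    linear_combination this
  have huv : ∀ t, (dataStats y z w).elim t = 0 → t / coefOf y z w t * coefOf y z w t = t :=
    fun t ht => div_mul_cancel₀ _ (nv t ht)
  have nω : ∀ t, (dataStats y z w).elim t = 0 →
      covOf y z w (t / coefOf y z w t) (coefOf y z w t) (coefH y z w t) (coefK y z w t) ≠ 0 := by
    intro t ht h
    have h1 := cov_eq hα (mp1 t ht) (mp2 t) rfl rfl rfl rfl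
    rw [covOf] at h
    rw [h, huv t ht, hroot t ht, mul_zero] at h1
    refine hd.cov_ne t ht ?_
    rw [covNum_eq _ (hd.minor_ne t ht), h1, mul_zero]
  have nu : ∀ t, (dataStats y z w).elim t = 0 → t / coefOf y z w t ≠ 0 :=
    fun t ht => div_ne_zero (hd.ne_zero t ht) (nv t ht)
  refine ⟨Set.Subset.antisymm ?_ ?_, ?_⟩
  · intro θ hθ
    have hθ' := hθ
    simp only [Set.mem_ofPred_eq, IsCriticalPoint, average_eq_mean] at hθ'
    obtain ⟨g11, g22, D0, h1, h2, -, -, h5⟩ := hθ'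
    have hD : (concentration θ).det = θ.2 0 * θ.2 2 - θ.2 1 * θ.2 1 := by
      simp [concentration, Matrix.det_fin_two_of]
    -- With `γ₁₂ = 0` the mean equations give pooled means, and the `γ₁₂`-equation becomes `y + ρ *
    -- σ * κ = 0`.
    have g12 : θ.2 1 ≠ 0 := by
      intro h0
      simp only [hD, h0, mul_zero, sub_zero, add_zero] at h1 h2
      rw [h0] at h5
      rw [mul_div_assoc, div_self g22, mul_one] at h1
      rw [mul_comm (θ.2 0), mul_div_assoc, div_self g11, mul_one] at h2
      have k1 : (n : ℂ) * ((mean fun j => y j 0) - θ.1 0) + r * (mean z - θ.1 0) = 0 := by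
        refine mul_left_cancel₀ g11 ?_; linear_combination h1
      have k2 : (n : ℂ) * ((mean fun j => y j 1) - θ.1 1) + s * (mean w - θ.1 1) = 0 := by
        refine mul_left_cancel₀ g22 ?_; linear_combination h2
      have k3 : (mean fun j => y j 0) - θ.1 0 = -((dataStats y z w).ρ * shift₁ y z) := by
        rw [hρ, shift₁]; field_simp; linear_combination k1
      have k4 : (mean fun j => y j 1) - θ.1 1 = -((dataStats y z w).σ * shift₂ y w) := by
        rw [hσ, shift₂]; field_simp; linear_combination k2
      have k5 : (mean fun j => y j 0 * y j 1) - (mean fun j => y j 0) * (mean fun j => y j 1)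
          + ((mean fun j => y j 0) - θ.1 0) * ((mean fun j => y j 1) - θ.1 1) = 0 := by
        refine mul_left_cancel₀ cn ?_
        simp only [zero_div, mul_zero, zero_mul, neg_zero, add_zero] at h5
        linear_combination -h5
      rw [k3, k4] at k5
      refine hd.y_ne ?_
      have e1 : (dataStats y z w).y = (mean (fun j => y j 0 * y j 1)
        - mean (fun j => y j 0) * mean fun j => y j 1) * (shift₁ y z * shift₂ y w) := rfl
      have e2 : (dataStats y z w).κ = shift₁ y z ^ 2 * shift₂ y w ^ 2 := rfl
      rw [e1, e2]
      linear_combination shift₁ y z * shift₂ y w * k5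
    obtain ⟨u, hu⟩ : ∃ u, u = -θ.2 1 / θ.2 2 := ⟨_, rfl⟩
    obtain ⟨v, hv⟩ : ∃ v, v = -θ.2 1 / θ.2 0 := ⟨_, rfl⟩
    obtain ⟨ω, hω⟩ : ∃ ω, ω = -θ.2 1 / (θ.2 0 * θ.2 2) := ⟨_, rfl⟩
    have u0 : u ≠ 0 := by rw [hu]; exact div_ne_zero (neg_ne_zero.2 g12) g22
    have v0 : v ≠ 0 := by rw [hv]; exact div_ne_zero (neg_ne_zero.2 g12) g11
    have ω0 : ω ≠ 0 := by
      rw [hω]; exact div_ne_zero (neg_ne_zero.2 g12) (mul_ne_zero g11 g22)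
    have t1 : 1 - u * v ≠ 0 := by
      have : 1 - u * v = (concentration θ).det / (θ.2 0 * θ.2 2) := by
        rw [hD, hu, hv]; field_simp
      rw [this]; exact div_ne_zero D0 (mul_ne_zero g11 g22)
    obtain ⟨H, hH⟩ : ∃ H, H = (mean z - θ.1 0) / (1 - (dataStats y z w).ρ) := ⟨_, rfl⟩
    obtain ⟨K, hK⟩ : ∃ K, K = (mean w - θ.1 1) / (1 - (dataStats y z w).σ) := ⟨_, rfl⟩
    have hθe : θ = paramOf (mean z) (mean w) (dataStats y z w).ρ (dataStats y z w).σ u v H K ω := by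
      have hρ1' : 1 - (dataStats y z w).ρ ≠ 0 := by rw [hρ1]; exact div_ne_zero cn cnr
      have hσ1' : 1 - (dataStats y z w).σ ≠ 0 := by rw [hσ1]; exact div_ne_zero cn cns
      refine Prod.ext ?_ ?_
      · funext i
        fin_cases i
        · simp only [paramOf, hH]
          simp [mul_div_cancel₀ _ hρ1']
        · simp only [paramOf, hK]
          simp [mul_div_cancel₀ _ hσ1']
      · funext i
        fin_cases i
        · simp [paramOf, hu, hω]; field_simp
        · simp [paramOf, hu, hv, hω]; field_simp
        · simp [paramOf, hv, hω]; field_simp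
    have hc := hθ
    rw [Set.mem_ofPred_eq, hθe, isCriticalPoint_paramOf_iff y z w hn hr hs hα hβ u0 v0 ω0 t1] at hc
    obtain ⟨c1, c2, c3, c4, c5⟩ := hc
    have ht : (dataStats y z w).elim (u * v) = 0 :=
      (mul_eq_zero.1 (elim_mul_eq_zero _ c4 c5)).resolve_left (mul_ne_zero u0 v0)
    have hp : (dataStats y z w).root (u * v) = (dataStats y z w).σ * v * K / shift₁ y z := by
      have := minor_linear _ c4 c5
      rw [root, div_eq_iff (hd.minor_ne _ ht)]
      linear_combination -this
    have hcoef : coefOf y z w (u * v) = v := by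
      rw [coefOf, hp, slope_eq hα c1 c2]
      field_simp
    have hcu : u * v / coefOf y z w (u * v) = u := by
      rw [hcoef]; field_simp
    have hcH : coefH y z w (u * v) = H := by
      rw [coefH, hp]; field_simp; linear_combination -c1
    have hcK : coefK y z w (u * v) = K := by
      rw [coefK, hcu, hcH, ← c2]; ring
    refine ⟨u * v, ht, ?_⟩
    rw [critOf, hcu, hcoef, hcH, hcK, ← c3, hθe]
  · rintro _ ⟨t, ht, rfl⟩
    rw [Set.mem_ofPred_eq, critOf, isCriticalPoint_paramOf_iff y z w hn hr hs hα hβ (nu t ht)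
      (nv t ht) (nω t ht) (by rw [huv t ht]; exact hd.ne_one t ht)]
    refine ⟨mp1 t ht, mp2 t, rfl, ?_, ?_⟩
    · rw [huv t ht, hroot t ht]; exact eqA_root _ (hd.minor_ne t ht) ht
    · rw [huv t ht, hroot t ht]; exact eqB_root _ (hd.minor_ne t ht) ht
  -- The squared correlation `γ₁₂ ^ 2 / (γ₁₁ * γ₂₂)` recovers `t`.
  · have : Set.LeftInvOn (fun θ : Params ℂ => θ.2 1 ^ 2 / (θ.2 0 * θ.2 2)) (critOf y z w)
        {t | (dataStats y z w).elim t = 0} := by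
      intro t ht
      have h1 := nu t ht
      have h2 := nv t ht
      have h3 := nω t ht
      have h4 := huv t ht
      simp only [critOf, paramOf, Matrix.cons_val_zero, Matrix.cons_val_one, Matrix.cons_val]
      conv_rhs => rw [← h4]
      generalize covOf y z w (t / coefOf y z w t) (coefOf y z w t) (coefH y z w t)
        (coefK y z w t) = ω at *
      generalize t / coefOf y z w t = u at *
      field_simp
    exact this.injOn

lemma encard_isCriticalPoint (hn : 0 < n) (hr : 0 < r) (hs : 0 < s)
    (hd : (dataStats y z w).Nondegenerate) : {θ | IsCriticalPoint y z w θ}.encard = 9 := by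
  obtain ⟨h1, h2⟩ := setOf_isCriticalPoint_eq y z w hn hr hs hd
  rw [h1, h2.encard_image]
  refine hd.encard_roots ?_ ?_
  · have : (n : ℂ) + r ≠ 0 := by exact_mod_cast (by omega : n + r ≠ 0)
    simpa [dataStats, hr.ne'] using this
  · have : (n : ℂ) + s ≠ 0 := by exact_mod_cast (by omega : n + s ≠ 0)
    simpa [dataStats, hs.ne'] using this

end

/-! ### Data realizing the nondegenerate statistics -/

lemma mean_cons_two {k : ℕ} (a b c : ℝ) :
    mean (Fin.cons a (Fin.cons b fun _ => c) : Fin (k + 2) → ℝ) = (a + b + k * c) / (k + 2) := by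
  simp [mean, Fin.sum_univ_succ]
  field_simp
  ring

lemma mean_cons_three {k : ℕ} (a b c e : ℝ) :
    mean (Fin.cons a (Fin.cons b (Fin.cons c fun _ => e)) : Fin (k + 3) → ℝ)
      = (a + b + c + k * e) / (k + 3) := by
  simp [mean, Fin.sum_univ_succ]
  rw [show ((k : ℝ) + 2 + 1) = k + 3 by ring]
  field_simp
  ring

lemma exists_mean_eq_one {r : ℕ} (hr : 2 ≤ r) {A : ℝ} (hA : 0 < A) :
    ∃ z : Fin r → ℝ, mean z = 1 ∧ mean (fun j => z j ^ 2) = 1 + A := by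
  obtain ⟨k, rfl⟩ := Nat.exists_eq_add_of_le' hr
  have hk : (0 : ℝ) < k + 2 := by positivity
  have ha : √((k + 2) * A / 2) ^ 2 = (k + 2) * A / 2 := Real.sq_sqrt (by positivity)
  -- Two observations lie symmetrically about the mean `1` and carry all the variance; the rest
  -- equal `1`.
  refine ⟨Fin.cons (1 + √((k + 2) * A / 2)) (Fin.cons (1 - √((k + 2) * A / 2)) fun _ => 1), ?_, ?_⟩
  · rw [mean_cons_two]; field_simp; ring
  · have : (fun j => (Fin.cons (1 + √((k + 2) * A / 2))
        (Fin.cons (1 - √((k + 2) * A / 2)) fun _ => 1) : Fin (k + 2) → ℝ) j ^ 2)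
        = Fin.cons ((1 + √((k + 2) * A / 2)) ^ 2) (Fin.cons ((1 - √((k + 2) * A / 2)) ^ 2)
          fun _ => 1) := by
      funext j
      refine Fin.cases ?_ (fun j => ?_) j
      · simp
      · refine Fin.cases ?_ (fun j => ?_) j <;> simp
    rw [this, mean_cons_two, div_eq_iff hk.ne']
    linear_combination 2 * ha

lemma exists_mean_eq_zero {n : ℕ} (hn : 3 ≤ n) {c : ℝ} (hc : c ^ 2 < 1) :
    ∃ y : Fin n → Fin 2 → ℝ, (mean fun j => y j 0) = 0 ∧ (mean fun j => y j 1) = 0 ∧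
      (mean fun j => y j 0 ^ 2) = 1 ∧ (mean fun j => y j 0 * y j 1) = c ∧
      (mean fun j => y j 1 ^ 2) = 1 := by
  obtain ⟨k, rfl⟩ := Nat.exists_eq_add_of_le' hn
  have hk : (0 : ℝ) < k + 3 := by positivity
  obtain ⟨a, ha⟩ : ∃ a : ℝ, a ^ 2 = (k + 3) / 2 := ⟨√((k + 3) / 2), Real.sq_sqrt (by positivity)⟩
  obtain ⟨b, hb⟩ : ∃ b : ℝ, b ^ 2 = (1 - c ^ 2) * (k + 3) / 6 :=
    ⟨√((1 - c ^ 2) * (k + 3) / 6), Real.sq_sqrt (by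
      have : 0 < 1 - c ^ 2 := by linarith
      positivity)⟩
  -- Three centred points carry the covariance and the rest are zero: `2 * a ^ 2 = n` gives variance
  -- 1 and covariance `c`, and `b` makes the second variance 1. Two centred points would be
  -- collinear with the origin.
  refine ⟨Fin.cons ![a, b + a * c] (Fin.cons ![-a, b - a * c] (Fin.cons ![0, -2 * b] fun _ => 0)),
    ?_⟩
  have key (f : (Fin 2 → ℝ) → ℝ) : (mean fun j => f ((Fin.cons ![a, b + a * c]
      (Fin.cons ![-a, b - a * c] (Fin.cons ![0, -2 * b] fun _ => 0)) :
        Fin (k + 3) → Fin 2 → ℝ) j))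
      = (f ![a, b + a * c] + f ![-a, b - a * c] + f ![0, -2 * b] + k * f 0) / (k + 3) := by
    rw [← mean_cons_three]
    congr 1
    funext j
    refine Fin.cases ?_ (fun j => ?_) j
    · simp
    · refine Fin.cases ?_ (fun j => ?_) j
      · simp
      · exact Fin.cases rfl (fun j => rfl) j
  refine ⟨(key fun v => v 0).trans ?_, (key fun v => v 1).trans ?_, (key fun v => v 0 ^ 2).trans ?_,
    (key fun v => v 0 * v 1).trans ?_, (key fun v => v 1 ^ 2).trans ?_⟩ <;>
    rw [div_eq_iff hk.ne'] <;> simp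
  · ring
  · linear_combination 2 * ha
  · linear_combination 2 * c * ha
  · linear_combination 6 * hb + 2 * c ^ 2 * ha

/-- Complete cases with mean 0 and marginal cases with mean 1 make both shifts equal to 1, so the
statistics are exactly those of `sample`. -/
lemma exists_nondegenerate_data {n r s : ℕ} (hn : 3 ≤ n) (hr : 2 ≤ r) (hs : 2 ≤ s) :
    ∃ (y : Fin n → Fin 2 → ℝ) (z : Fin r → ℝ) (w : Fin s → ℝ),
      (dataStats (fun j i => (y j i : ℂ)) (fun j => (z j : ℂ))
        (fun j => (w j : ℂ))).Nondegenerate := by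
  have pn : (0 : ℝ) < n := by exact_mod_cast (by omega : 0 < n)
  have pr : (0 : ℝ) < r := by exact_mod_cast (by omega : 0 < r)
  have ps : (0 : ℝ) < s := by exact_mod_cast (by omega : 0 < s)
  have hσ0 : 0 < (s : ℝ) / (n + s) := by positivity
  have hσ1 : (s : ℝ) / (n + s) < 1 := by rw [div_lt_one (by positivity)]; linarith
  obtain ⟨A, B, hA, hB, h⟩ := exists_nondegenerate (ρ := r / (n + r)) (σ := s / (n + s))
    (by positivity) (by rw [div_lt_one (by positivity)]; linarith) hσ0 hσ1
  obtain ⟨y, y1, y2, y3, y4, y5⟩ := exists_mean_eq_zero hn (c := (s : ℝ) / (n + s) / 2) (by nlinarith)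
  obtain ⟨z, z1, z2⟩ := exists_mean_eq_one hr hA
  obtain ⟨w, w1, w2⟩ := exists_mean_eq_one hs hB
  refine ⟨y, z, w, ?_⟩
  have e1 := map_dataStats y z w Complex.ofRealAm
  simp only [Complex.ofRealAm_coe] at e1
  rw [← e1]
  convert h using 1
  simp [dataStats, Stats.map, sample, shift₁, shift₂, y1, y2, y3, y4, y5, z1, z2, w1, w2]

lemma exists_nondegenerate_polynomial {n r s : ℕ} (hn : 3 ≤ n) (hr : 2 ≤ r) (hs : 2 ≤ s) :
    ∃ F : MvPolynomial ((Fin n × Fin 2) ⊕ (Fin r ⊕ Fin s)) ℝ, F ≠ 0 ∧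
      ∀ (y : Fin n → Fin 2 → ℝ) (z : Fin r → ℝ) (w : Fin s → ℝ),
        MvPolynomial.eval (Sum.elim (fun p => y p.1 p.2) (Sum.elim z w)) F ≠ 0 →
        (dataStats (fun j i => (y j i : ℂ)) (fun j => (z j : ℂ))
          (fun j => (w j : ℂ))).Nondegenerate := by
  -- The statistics of the universal data set, whose entries are the variables; every real data set
  -- is a specialization of it.
  set d : Stats (MvPolynomial ((Fin n × Fin 2) ⊕ (Fin r ⊕ Fin s)) ℝ) :=
    dataStats (fun j i => MvPolynomial.X (Sum.inl (j, i)))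
      (fun j => MvPolynomial.X (Sum.inr (Sum.inl j)))
      (fun j => MvPolynomial.X (Sum.inr (Sum.inr j))) with hd
  obtain ⟨y₀, z₀, w₀, h₀⟩ := exists_nondegenerate_data hn hr hs
  let ψ (y : Fin n → Fin 2 → ℝ) (z : Fin r → ℝ) (w : Fin s → ℝ) :
      MvPolynomial ((Fin n × Fin 2) ⊕ (Fin r ⊕ Fin s)) ℝ →ₐ[ℝ] ℂ :=
    MvPolynomial.aeval fun i =>
      ((Sum.elim (fun p => y p.1 p.2) (Sum.elim z w) : _ → ℝ) i : ℂ)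
  have hψ (y : Fin n → Fin 2 → ℝ) (z : Fin r → ℝ) (w : Fin s → ℝ) : d.map (ψ y z w : _ →+* ℂ) =
      dataStats (fun j i => (y j i : ℂ)) (fun j => (z j : ℂ)) (fun j => (w j : ℂ)) := by
    refine (map_dataStats _ _ _ (ψ y z w)).trans ?_
    simp [ψ]
  have hψF (y : Fin n → Fin 2 → ℝ) (z : Fin r → ℝ) (w : Fin s → ℝ)
      (F : MvPolynomial ((Fin n × Fin 2) ⊕ (Fin r ⊕ Fin s)) ℝ) : ψ y z w F =
      (MvPolynomial.eval (Sum.elim (fun p => y p.1 p.2) (Sum.elim z w)) F : ℝ) := by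
    have := MvPolynomial.aeval_algebraMap_apply ℂ
      (Sum.elim (fun p : Fin n × Fin 2 => y p.1 p.2) (Sum.elim z w)) F
    simpa [ψ, MvPolynomial.aeval_eq_eval, Function.comp_def] using this
  obtain ⟨F, hF, hF'⟩ := exists_nondegenerate_locus d (ψ y₀ z₀ w₀ : _ →+* ℂ)
    (by rw [hψ]; exact h₀)
    (by
      have : (n : ℂ) + r ≠ 0 := by exact_mod_cast (by omega : n + r ≠ 0)
      have h2 : (r : ℂ) ≠ 0 := by exact_mod_cast (by omega : r ≠ 0)
      change (d.map (ψ y₀ z₀ w₀ : _ →+* ℂ)).ρ ≠ 0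
      rw [hψ]
      simp [dataStats, this, show r ≠ 0 by omega])
    (by
      have : (n : ℂ) + s ≠ 0 := by exact_mod_cast (by omega : n + s ≠ 0)
      change (d.map (ψ y₀ z₀ w₀ : _ →+* ℂ)).σ ≠ 0
      rw [hψ]
      simp [dataStats, this, show s ≠ 0 by omega])
  refine ⟨F, ?_, fun y z w h => ?_⟩
  · rintro rfl
    simp at hF
  · rw [← hψ]
    refine hF' _ ?_
    change ψ y z w F ≠ 0
    rw [hψF]
    exact_mod_cast h

theorem isMLDegree_nine {n r s : ℕ} (hn : 3 ≤ n) (hr : 2 ≤ r) (hs : 2 ≤ s) :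
    IsMLDegree n r s 9 := by
  obtain ⟨F, hF, h⟩ := exists_nondegenerate_polynomial hn hr hs
  exact ⟨F, hF, fun y z w hyzw => encard_isCriticalPoint _ _ _ (by omega) (by omega) (by omega)
    (h y z w hyzw)⟩

/-! ### Existence of a maximum of the likelihood -/

lemma mem_parameterSpace {θ : Params ℝ} :
    θ ∈ parameterSpace ↔ 0 < θ.2 0 ∧ 0 < θ.2 0 * θ.2 2 - θ.2 1 ^ 2 := by
  have hdet : (concentration θ).det = θ.2 0 * θ.2 2 - θ.2 1 ^ 2 := by
    rw [concentration, Matrix.det_fin_two_of]; ring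
  constructor
  · intro h
    refine ⟨by simpa [concentration] using Matrix.PosDef.diag_pos h (i := 0), ?_⟩
    rw [← hdet]
    exact Matrix.PosDef.det_pos h
  · rintro ⟨h1, h2⟩
    refine Matrix.PosDef.of_dotProduct_mulVec_pos ?_ fun x hx => ?_
    · ext i j
      fin_cases i <;> fin_cases j <;> simp [concentration]
    · have e : star x ⬝ᵥ (concentration θ).mulVec x
          = θ.2 0 * x 0 ^ 2 + 2 * θ.2 1 * x 0 * x 1 + θ.2 2 * x 1 ^ 2 := by
        simp [concentration, Matrix.mulVec, dotProduct, Fin.sum_univ_two]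
        ring
      rw [e]
      have h3 : θ.2 0 * (θ.2 0 * x 0 ^ 2 + 2 * θ.2 1 * x 0 * x 1 + θ.2 2 * x 1 ^ 2)
          = (θ.2 0 * x 0 + θ.2 1 * x 1) ^ 2 + (θ.2 0 * θ.2 2 - θ.2 1 ^ 2) * x 1 ^ 2 := by ring
      refine pos_of_mul_pos_right (a := θ.2 0) ?_ h1.le
      rw [h3]
      by_cases hx1 : x 1 = 0
      · have hx0 : x 0 ≠ 0 := by
          intro h0
          apply hx
          funext i
          fin_cases i
          · exact h0
          · exact hx1
        rw [hx1]
        have : 0 < (θ.2 0 * x 0) ^ 2 := by positivity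
        simpa using this
      · have : 0 < (θ.2 0 * θ.2 2 - θ.2 1 ^ 2) * x 1 ^ 2 := mul_pos h2 (by positivity)
        positivity

/-- The numbers on which the likelihood depends: sample sizes, sample means and sample
(co)variances. -/
structure Moments where
  n : ℝ
  r : ℝ
  s : ℝ
  Y₁ : ℝ
  Y₂ : ℝ
  s₁₁ : ℝ
  s₁₂ : ℝ
  s₂₂ : ℝ
  Z : ℝ
  zz : ℝ
  W : ℝ
  ww : ℝ

namespace Moments

variable (M : Moments)

/-- The log-likelihood up to an additive constant. -/
noncomputable def like (m₁ m₂ g₁₁ g₁₂ g₂₂ : ℝ) : ℝ :=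
  (M.n + M.r + M.s) / 2 * Real.log (g₁₁ * g₂₂ - g₁₂ ^ 2) - M.r / 2 * Real.log g₂₂
    - M.s / 2 * Real.log g₁₁
    - M.n / 2 * (g₁₁ * (M.s₁₁ + (M.Y₁ - m₁) ^ 2)
      + 2 * g₁₂ * (M.s₁₂ + (M.Y₁ - m₁) * (M.Y₂ - m₂)) + g₂₂ * (M.s₂₂ + (M.Y₂ - m₂) ^ 2))
    - M.r / 2 * ((M.zz + (M.Z - m₁) ^ 2) * (g₁₁ - g₁₂ ^ 2 / g₂₂))
    - M.s / 2 * ((M.ww + (M.W - m₂) ^ 2) * (g₂₂ - g₁₂ ^ 2 / g₁₁))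

lemma form_nonneg {a b c : ℝ} (ha : 0 < a) (h : 0 < a * c - b ^ 2) (x y : ℝ) :
    0 ≤ a * x ^ 2 + 2 * b * x * y + c * y ^ 2 := by
  have h3 : a * (a * x ^ 2 + 2 * b * x * y + c * y ^ 2)
      = (a * x + b * y) ^ 2 + (a * c - b ^ 2) * y ^ 2 := by ring
  refine nonneg_of_mul_nonneg_right (a := a) ?_ ha
  rw [h3]
  positivity

variable {M} (hn : 0 < M.n) (hr : 0 < M.r) (hs : 0 < M.s) (h₁₁ : 0 < M.s₁₁)
  (hdet : 0 < M.s₁₁ * M.s₂₂ - M.s₁₂ ^ 2) (hzz : 0 < M.zz) (hww : 0 < M.ww)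

lemma log_sub_le {a x A : ℝ} (ha : 0 < a) (hA : a ≤ A) (hx : 0 < x) :
    Real.log x - A * x ≤ -1 - Real.log a := by
  have h1 := Real.log_le_sub_one_of_pos (mul_pos ha hx)
  rw [Real.log_mul ha.ne' hx.ne'] at h1
  have h2 : a * x ≤ A * x := by gcongr
  linarith

include hr hs hzz hww in
-- A marginal sample contributes `log x - a * x` in its precision `x`, with `a` at least the sample
-- variance; this is bounded above, so only the complete cases must force decay.
lemma like_le {m₁ m₂ g₁₁ g₁₂ g₂₂ : ℝ} (hg : 0 < g₁₁) (hD : 0 < g₁₁ * g₂₂ - g₁₂ ^ 2) :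
    M.like m₁ m₂ g₁₁ g₁₂ g₂₂ ≤ M.n / 2 * (Real.log (g₁₁ * g₂₂ - g₁₂ ^ 2)
      - (g₁₁ * (M.s₁₁ + (M.Y₁ - m₁) ^ 2)
      + 2 * g₁₂ * (M.s₁₂ + (M.Y₁ - m₁) * (M.Y₂ - m₂)) + g₂₂ * (M.s₂₂ + (M.Y₂ - m₂) ^ 2)))
      + M.r / 2 * (-1 - Real.log M.zz) + M.s / 2 * (-1 - Real.log M.ww) := by
  have hg2 : 0 < g₂₂ := by
    refine pos_of_mul_pos_right (a := g₁₁) ?_ hg.le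
    nlinarith [sq_nonneg g₁₂]
  have e1 : g₁₁ - g₁₂ ^ 2 / g₂₂ = (g₁₁ * g₂₂ - g₁₂ ^ 2) / g₂₂ := by field_simp
  have e2 : g₂₂ - g₁₂ ^ 2 / g₁₁ = (g₁₁ * g₂₂ - g₁₂ ^ 2) / g₁₁ := by field_simp
  have h1 := log_sub_le hzz (le_add_of_nonneg_right (sq_nonneg (M.Z - m₁))) (div_pos hD hg2)
  have h2 := log_sub_le hww (le_add_of_nonneg_right (sq_nonneg (M.W - m₂))) (div_pos hD hg)
  rw [Real.log_div hD.ne' hg2.ne'] at h1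
  rw [Real.log_div hD.ne' hg.ne'] at h2
  have h1' := mul_le_mul_of_nonneg_left h1 (half_pos hr).le
  have h2' := mul_le_mul_of_nonneg_left h2 (half_pos hs).le
  rw [like, e1, e2]
  linarith

include h₁₁ hdet in
/-- The complete-data part of the likelihood tends to `-∞` outside compact sets. -/
lemma exists_bound (T : ℝ) : ∃ C δ R : ℝ, 0 < δ ∧ ∀ m₁ m₂ g₁₁ g₁₂ g₂₂ : ℝ, 0 < g₁₁ →
    0 < g₁₁ * g₂₂ - g₁₂ ^ 2 → T ≤ Real.log (g₁₁ * g₂₂ - g₁₂ ^ 2)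
      - (g₁₁ * (M.s₁₁ + (M.Y₁ - m₁) ^ 2)
      + 2 * g₁₂ * (M.s₁₂ + (M.Y₁ - m₁) * (M.Y₂ - m₂)) + g₂₂ * (M.s₂₂ + (M.Y₂ - m₂) ^ 2)) →
    g₁₁ + g₂₂ ≤ C ∧ δ ≤ g₁₁ * g₂₂ - g₁₂ ^ 2 ∧ (M.Y₁ - m₁) ^ 2 + (M.Y₂ - m₂) ^ 2 ≤ R := by
  have h₂₂ : 0 < M.s₂₂ := by
    refine pos_of_mul_pos_right (a := M.s₁₁) ?_ h₁₁.le
    nlinarith [sq_nonneg M.s₁₂]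
  -- Let `S` be the sample covariance. `l = det S / tr S` is a lower bound for its smallest
  -- eigenvalue; half of it will absorb the logarithms.
  obtain ⟨l, hl⟩ : ∃ l, l = (M.s₁₁ * M.s₂₂ - M.s₁₂ ^ 2) / (M.s₁₁ + M.s₂₂) := ⟨_, rfl⟩
  have hl0 : 0 < l := by rw [hl]; exact div_pos hdet (by positivity)
  obtain ⟨c, hc⟩ : ∃ c, c = -1 - Real.log (l / 2) := ⟨_, rfl⟩
  obtain ⟨C, hC⟩ : ∃ C, C = 2 / l * (2 * c - T) := ⟨_, rfl⟩
  refine ⟨C, Real.exp T, C / Real.exp T * (2 * c - T), Real.exp_pos T, ?_⟩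
  intro m₁ m₂ g₁₁ g₁₂ g₂₂ hg hD hT
  have hg2 : 0 < g₂₂ := by
    refine pos_of_mul_pos_right (a := g₁₁) ?_ hg.le
    nlinarith [sq_nonneg g₁₂]
  obtain ⟨Q, hQ⟩ : ∃ Q, Q = g₁₁ * (M.Y₁ - m₁) ^ 2 + 2 * g₁₂ * (M.Y₁ - m₁) * (M.Y₂ - m₂)
    + g₂₂ * (M.Y₂ - m₂) ^ 2 := ⟨_, rfl⟩
  have hQ0 : 0 ≤ Q := by rw [hQ]; exact form_nonneg hg hD _ _
  have htr : l * (g₁₁ + g₂₂) ≤ g₁₁ * M.s₁₁ + 2 * g₁₂ * M.s₁₂ + g₂₂ * M.s₂₂ := by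
    rw [hl, div_mul_eq_mul_div, div_le_iff₀ (by positivity)]
    -- The two forms add up to `tr (S Γ S) ≥ 0`, and Cayley–Hamilton turns `S ^ 2` into `(tr S) S -
    -- det S`.
    linarith [form_nonneg hg hD M.s₁₁ M.s₁₂, form_nonneg hg hD M.s₁₂ M.s₂₂]
  have hlog : Real.log (g₁₁ * g₂₂ - g₁₂ ^ 2) ≤ Real.log g₁₁ + Real.log g₂₂ := by
    rw [← Real.log_mul hg.ne' hg2.ne']
    exact Real.log_le_log hD (by nlinarith [sq_nonneg g₁₂])
  have k1 := log_sub_le (half_pos hl0) le_rfl hg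
  have k2 := log_sub_le (half_pos hl0) le_rfl hg2
  have hT' : T ≤ Real.log (g₁₁ * g₂₂ - g₁₂ ^ 2)
      - (g₁₁ * M.s₁₁ + 2 * g₁₂ * M.s₁₂ + g₂₂ * M.s₂₂) - Q := by rw [hQ]; linarith
  have hpos : 0 < g₁₁ + g₂₂ := by positivity
  have hB : l / 2 * (g₁₁ + g₂₂) + Q ≤ 2 * c - T := by rw [hc]; linarith
  have hA1 : g₁₁ + g₂₂ ≤ C := by
    rw [hC, div_mul_eq_mul_div, le_div_iff₀ hl0]; linarith
  have hA2 : Real.exp T ≤ g₁₁ * g₂₂ - g₁₂ ^ 2 := by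
    rw [← Real.le_log_iff_exp_le hD]
    have := mul_pos hl0 hpos
    linarith
  refine ⟨hA1, hA2, ?_⟩
  -- With `e` the mean residual this is `|Γ e| ^ 2 ≥ 0`, again by Cayley–Hamilton.
  have h5 : (g₁₁ * g₂₂ - g₁₂ ^ 2) * ((M.Y₁ - m₁) ^ 2 + (M.Y₂ - m₂) ^ 2) ≤ (g₁₁ + g₂₂) * Q := by
    rw [hQ]
    nlinarith [sq_nonneg (g₁₁ * (M.Y₁ - m₁) + g₁₂ * (M.Y₂ - m₂)),
      sq_nonneg (g₁₂ * (M.Y₁ - m₁) + g₂₂ * (M.Y₂ - m₂))]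
  rw [div_mul_eq_mul_div, le_div_iff₀ (Real.exp_pos T), mul_comm _ (Real.exp T)]
  have hQ1 : Q ≤ 2 * c - T := by
    have := mul_pos hl0 hpos
    linarith
  calc Real.exp T * ((M.Y₁ - m₁) ^ 2 + (M.Y₂ - m₂) ^ 2)
      ≤ (g₁₁ * g₂₂ - g₁₂ ^ 2) * ((M.Y₁ - m₁) ^ 2 + (M.Y₂ - m₂) ^ 2) := by gcongr
    _ ≤ (g₁₁ + g₂₂) * Q := h5
    _ ≤ C * (2 * c - T) := by
      have : 0 ≤ C := hpos.le.trans hA1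
      gcongr

lemma continuousOn_like : ContinuousOn
    (fun θ : Params ℝ => M.like (θ.1 0) (θ.1 1) (θ.2 0) (θ.2 1) (θ.2 2)) parameterSpace := by
  intro θ hθ
  obtain ⟨h1, h2⟩ := mem_parameterSpace.1 hθ
  have hg2 : 0 < θ.2 2 := by
    refine pos_of_mul_pos_right (a := θ.2 0) ?_ h1.le
    nlinarith [sq_nonneg (θ.2 1)]
  refine ContinuousAt.continuousWithinAt ?_
  have l1 : ContinuousAt (fun θ : Params ℝ => Real.log (θ.2 0 * θ.2 2 - θ.2 1 ^ 2)) θ :=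
    ContinuousAt.log (by fun_prop) h2.ne'
  have l2 : ContinuousAt (fun θ : Params ℝ => Real.log (θ.2 2)) θ :=
    ContinuousAt.log (by fun_prop) hg2.ne'
  have l3 : ContinuousAt (fun θ : Params ℝ => Real.log (θ.2 0)) θ :=
    ContinuousAt.log (by fun_prop) h1.ne'
  have l4 : ContinuousAt (fun θ : Params ℝ => θ.2 1 ^ 2 / θ.2 2) θ :=
    ContinuousAt.div (by fun_prop) (by fun_prop) hg2.ne'
  have l5 : ContinuousAt (fun θ : Params ℝ => θ.2 1 ^ 2 / θ.2 0) θ :=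
    ContinuousAt.div (by fun_prop) (by fun_prop) h1.ne'
  simp only [like]
  fun_prop

include hn hr hs h₁₁ hdet hzz hww in
lemma exists_isMaxOn : ∃ θ ∈ parameterSpace, IsMaxOn
    (fun θ : Params ℝ => M.like (θ.1 0) (θ.1 1) (θ.2 0) (θ.2 1) (θ.2 2)) parameterSpace θ := by
  set L := fun θ : Params ℝ => M.like (θ.1 0) (θ.1 1) (θ.2 0) (θ.2 1) (θ.2 2) with hL
  let θ₀ : Params ℝ := (![0, 0], ![1, 0, 1])
  have hθ₀ : θ₀ ∈ parameterSpace := by rw [mem_parameterSpace]; simp [θ₀]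
  -- The threshold is what the complete cases must still contribute for the likelihood to reach its
  -- value at `θ₀`.
  obtain ⟨C, δ, R, hδ, hb⟩ := exists_bound (M := M) h₁₁ hdet
    ((L θ₀ - M.r / 2 * (-1 - Real.log M.zz) - M.s / 2 * (-1 - Real.log M.ww)) / (M.n / 2))
  -- Non-strict inequalities make `S` closed, while `δ > 0` keeps it away from the singular
  -- matrices.
  let S : Set (Params ℝ) := {θ | 0 ≤ θ.2 0 ∧ 0 ≤ θ.2 2 ∧ θ.2 0 + θ.2 2 ≤ C ∧
    δ ≤ θ.2 0 * θ.2 2 - θ.2 1 ^ 2 ∧ (M.Y₁ - θ.1 0) ^ 2 + (M.Y₂ - θ.1 1) ^ 2 ≤ R}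
  have hS : S ⊆ parameterSpace := by
    rintro θ ⟨h1, h2, -, h4, -⟩
    rw [mem_parameterSpace]
    have h5 := hδ.trans_le h4
    refine ⟨lt_of_le_of_ne h1 fun h => ?_, h5⟩
    rw [← h] at h5
    nlinarith [sq_nonneg (θ.2 1)]
  have key : ∀ θ ∈ parameterSpace, L θ₀ ≤ L θ → θ ∈ S := by
    intro θ hθ h
    obtain ⟨h1, h2⟩ := mem_parameterSpace.1 hθ
    have hg2 : 0 < θ.2 2 := by
      refine pos_of_mul_pos_right (a := θ.2 0) ?_ h1.le
      nlinarith [sq_nonneg (θ.2 1)]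
    have hle := like_le hr hs hzz hww (m₁ := θ.1 0) (m₂ := θ.1 1) h1 h2
    obtain ⟨b1, b2, b3⟩ := hb (θ.1 0) (θ.1 1) (θ.2 0) (θ.2 1) (θ.2 2) h1 h2 (by
      rw [div_le_iff₀ (half_pos hn)]
      have := h.trans hle
      linarith)
    exact ⟨h1.le, hg2.le, b1, b2, b3⟩
  have hclosed : IsClosed S := by
    simp only [S, Set.ofPred_and]
    refine IsClosed.inter (isClosed_le ?_ ?_) (IsClosed.inter (isClosed_le ?_ ?_)
      (IsClosed.inter (isClosed_le ?_ ?_) (IsClosed.inter (isClosed_le ?_ ?_)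
      (isClosed_le ?_ ?_)))) <;> fun_prop
  have hbdd : Bornology.IsBounded S := by
    have sub : S ⊆ Set.Icc (![M.Y₁ - (R + 1), M.Y₂ - (R + 1)], ![0, -C, 0])
        (![M.Y₁ + (R + 1), M.Y₂ + (R + 1)], ![C, C, C]) := by
      rintro θ ⟨h1, h2, h3, h4, h5⟩
      have k1 : θ.2 1 ^ 2 ≤ C ^ 2 := by nlinarith
      have hC : 0 ≤ C := by linarith
      have k2 := abs_le_of_sq_le_sq' k1 hC
      have hR : 0 ≤ R := le_trans (by positivity) h5
      -- The bound `R + 1` replaces the square root of `R`.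
      have k3 := abs_le_of_sq_le_sq' (a := M.Y₁ - θ.1 0) (b := R + 1) (by nlinarith [sq_nonneg (M.Y₂ - θ.1 1)])
        (by linarith)
      have k4 := abs_le_of_sq_le_sq' (a := M.Y₂ - θ.1 1) (b := R + 1) (by nlinarith [sq_nonneg (M.Y₁ - θ.1 0)])
        (by linarith)
      refine ⟨⟨fun i => ?_, fun i => ?_⟩, fun i => ?_, fun i => ?_⟩ <;> fin_cases i <;>
        simp <;> linarith
    exact (Metric.isBounded_Icc _ _).subset sub
  have hcomp : IsCompact S := Metric.isCompact_of_isClosed_isBounded hclosed hbdd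
  obtain ⟨θ, hθ, hmax⟩ := hcomp.exists_isMaxOn ⟨θ₀, key θ₀ hθ₀ le_rfl⟩
    ((continuousOn_like (M := M)).mono hS)
  refine ⟨θ, hS hθ, fun η hη => ?_⟩
  by_cases h : L θ₀ ≤ L η
  · exact hmax (key η hη h)
  · exact (not_le.1 h).le.trans (hmax (key θ₀ hθ₀ le_rfl))

/-- The partial derivatives of the likelihood. -/
lemma score_of_isMaxOn {θ : Params ℝ} (hθ : θ ∈ parameterSpace) (h : IsMaxOn
    (fun θ : Params ℝ => M.like (θ.1 0) (θ.1 1) (θ.2 0) (θ.2 1) (θ.2 2)) parameterSpace θ) :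
    M.n * ((M.Y₁ - θ.1 0) * θ.2 0 + (M.Y₂ - θ.1 1) * θ.2 1)
      + M.r * (θ.2 0 - θ.2 1 ^ 2 / θ.2 2) * (M.Z - θ.1 0) = 0 ∧
    M.n * ((M.Y₂ - θ.1 1) * θ.2 2 + (M.Y₁ - θ.1 0) * θ.2 1)
      + M.s * (θ.2 2 - θ.2 1 ^ 2 / θ.2 0) * (M.W - θ.1 1) = 0 ∧
    (M.n + M.r + M.s) / 2 * (θ.2 2 / (θ.2 0 * θ.2 2 - θ.2 1 ^ 2)) - M.s / 2 / θ.2 0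
      - M.n / 2 * (M.s₁₁ + (M.Y₁ - θ.1 0) ^ 2) - M.r / 2 * (M.zz + (M.Z - θ.1 0) ^ 2)
      - M.s / 2 * ((M.ww + (M.W - θ.1 1) ^ 2) * (θ.2 1 ^ 2 / θ.2 0 ^ 2)) = 0 ∧
    (M.n + M.r + M.s) / 2 * (θ.2 0 / (θ.2 0 * θ.2 2 - θ.2 1 ^ 2)) - M.r / 2 / θ.2 2
      - M.n / 2 * (M.s₂₂ + (M.Y₂ - θ.1 1) ^ 2)
      - M.r / 2 * ((M.zz + (M.Z - θ.1 0) ^ 2) * (θ.2 1 ^ 2 / θ.2 2 ^ 2))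
      - M.s / 2 * (M.ww + (M.W - θ.1 1) ^ 2) = 0 ∧
    (M.n + M.r + M.s) / 2 * (-(2 * θ.2 1) / (θ.2 0 * θ.2 2 - θ.2 1 ^ 2))
      - M.n * (M.s₁₂ + (M.Y₁ - θ.1 0) * (M.Y₂ - θ.1 1))
      + M.r * ((M.zz + (M.Z - θ.1 0) ^ 2) * (θ.2 1 / θ.2 2))
      + M.s * ((M.ww + (M.W - θ.1 1) ^ 2) * (θ.2 1 / θ.2 0)) = 0 := by
  obtain ⟨h1, h2⟩ := mem_parameterSpace.1 hθ
  have hg2 : 0 < θ.2 2 := by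
    refine pos_of_mul_pos_right (a := θ.2 0) ?_ h1.le
    nlinarith [sq_nonneg (θ.2 1)]
  -- The constraints are open, so the restriction to each coordinate line has a local maximum and
  -- its derivative vanishes.
  have hmax : ∀ m₁ m₂ g₁₁ g₁₂ g₂₂, 0 < g₁₁ → 0 < g₁₁ * g₂₂ - g₁₂ ^ 2 →
      M.like m₁ m₂ g₁₁ g₁₂ g₂₂ ≤ M.like (θ.1 0) (θ.1 1) (θ.2 0) (θ.2 1) (θ.2 2) := by
    intro m₁ m₂ g₁₁ g₁₂ g₂₂ k1 k2
    have := @h (![m₁, m₂], ![g₁₁, g₁₂, g₂₂]) (mem_parameterSpace.2 ⟨k1, k2⟩)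
    simpa using this
  generalize θ.1 0 = m₁ at *
  generalize θ.1 1 = m₂ at *
  generalize θ.2 0 = g₁₁ at *
  generalize θ.2 1 = g₁₂ at *
  generalize θ.2 2 = g₂₂ at *
  clear h hθ
  refine ⟨?_, ?_, ?_, ?_, ?_⟩
  · have hl : IsLocalMax (fun x => M.like x m₂ g₁₁ g₁₂ g₂₂) m₁ :=
      Filter.Eventually.of_forall fun x => hmax x m₂ g₁₁ g₁₂ g₂₂ h1 h2
    have d1 := (hasDerivAt_id m₁).const_sub M.Y₁
    have d2 := (hasDerivAt_id m₁).const_sub M.Z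
    have := hl.hasDerivAt_eq_zero ((((((((d1.pow 2).const_add M.s₁₁).const_mul g₁₁).add
      (((d1.mul_const (M.Y₂ - m₂)).const_add M.s₁₂).const_mul (2 * g₁₂))).add_const
      (g₂₂ * (M.s₂₂ + (M.Y₂ - m₂) ^ 2))).const_mul (M.n / 2)).const_sub
      ((M.n + M.r + M.s) / 2 * Real.log (g₁₁ * g₂₂ - g₁₂ ^ 2) - M.r / 2 * Real.log g₂₂
        - M.s / 2 * Real.log g₁₁)).sub
      ((((d2.pow 2).const_add M.zz).mul_const (g₁₁ - g₁₂ ^ 2 / g₂₂)).const_mul (M.r / 2)) |>.sub_const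
      (M.s / 2 * ((M.ww + (M.W - m₂) ^ 2) * (g₂₂ - g₁₂ ^ 2 / g₁₁))))
    simp only [id] at this
    norm_num at this
    linear_combination this
  · have hl : IsLocalMax (fun x => M.like m₁ x g₁₁ g₁₂ g₂₂) m₂ :=
      Filter.Eventually.of_forall fun x => hmax m₁ x g₁₁ g₁₂ g₂₂ h1 h2
    have d1 := (hasDerivAt_id m₂).const_sub M.Y₂
    have d2 := (hasDerivAt_id m₂).const_sub M.W
    have := hl.hasDerivAt_eq_zero (((((((d1.const_mul (M.Y₁ - m₁)).const_add M.s₁₂).const_mul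
      (2 * g₁₂)).const_add (g₁₁ * (M.s₁₁ + (M.Y₁ - m₁) ^ 2))).add
      (((d1.pow 2).const_add M.s₂₂).const_mul g₂₂) |>.const_mul (M.n / 2)).const_sub
      ((M.n + M.r + M.s) / 2 * Real.log (g₁₁ * g₂₂ - g₁₂ ^ 2) - M.r / 2 * Real.log g₂₂
        - M.s / 2 * Real.log g₁₁) |>.sub_const
      (M.r / 2 * ((M.zz + (M.Z - m₁) ^ 2) * (g₁₁ - g₁₂ ^ 2 / g₂₂)))).sub
      ((((d2.pow 2).const_add M.ww).mul_const (g₂₂ - g₁₂ ^ 2 / g₁₁)).const_mul (M.s / 2)))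
    simp only [id] at this
    norm_num at this
    linear_combination this
  · have hl : IsLocalMax (fun x => M.like m₁ m₂ x g₁₂ g₂₂) g₁₁ := by
      have e1 : ∀ᶠ x in nhds g₁₁, 0 < x := lt_mem_nhds h1
      have e2 : ∀ᶠ x in nhds g₁₁, 0 < x * g₂₂ - g₁₂ ^ 2 :=
        ContinuousAt.eventually_lt (by fun_prop) (by fun_prop) h2
      filter_upwards [e1, e2] with x k1 k2 using hmax m₁ m₂ x g₁₂ g₂₂ k1 k2
    have d := hasDerivAt_id g₁₁
    have d1 := ((d.mul_const g₂₂).sub_const (g₁₂ ^ 2)).log h2.ne'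
    have d2 := (hasDerivAt_const g₁₁ (g₁₂ ^ 2)).div d h1.ne'
    have := hl.hasDerivAt_eq_zero ((((((d1.const_mul ((M.n + M.r + M.s) / 2)).sub_const
      (M.r / 2 * Real.log g₂₂)).sub ((Real.hasDerivAt_log h1.ne').const_mul (M.s / 2))).sub
      ((((d.mul_const (M.s₁₁ + (M.Y₁ - m₁) ^ 2)).add_const
        (2 * g₁₂ * (M.s₁₂ + (M.Y₁ - m₁) * (M.Y₂ - m₂)))).add_const
        (g₂₂ * (M.s₂₂ + (M.Y₂ - m₂) ^ 2))).const_mul (M.n / 2))).sub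
      (((d.sub_const (g₁₂ ^ 2 / g₂₂)).const_mul (M.zz + (M.Z - m₁) ^ 2)).const_mul (M.r / 2))).sub
      (((d2.const_sub g₂₂).const_mul (M.ww + (M.W - m₂) ^ 2)).const_mul (M.s / 2)))
    simp only [id] at this
    norm_num at this
    linear_combination this
  · have hl : IsLocalMax (fun x => M.like m₁ m₂ g₁₁ g₁₂ x) g₂₂ := by
      have e2 : ∀ᶠ x in nhds g₂₂, 0 < g₁₁ * x - g₁₂ ^ 2 :=
        ContinuousAt.eventually_lt (by fun_prop) (by fun_prop) h2
      filter_upwards [e2] with x k2 using hmax m₁ m₂ g₁₁ g₁₂ x h1 k2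
    have d := hasDerivAt_id g₂₂
    have d1 := ((d.const_mul g₁₁).sub_const (g₁₂ ^ 2)).log h2.ne'
    have d2 := (hasDerivAt_const g₂₂ (g₁₂ ^ 2)).div d hg2.ne'
    have := hl.hasDerivAt_eq_zero ((((((d1.const_mul ((M.n + M.r + M.s) / 2)).sub
      ((Real.hasDerivAt_log hg2.ne').const_mul (M.r / 2))).sub_const
      (M.s / 2 * Real.log g₁₁)).sub
      (((d.mul_const (M.s₂₂ + (M.Y₂ - m₂) ^ 2)).const_add
        (g₁₁ * (M.s₁₁ + (M.Y₁ - m₁) ^ 2)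
          + 2 * g₁₂ * (M.s₁₂ + (M.Y₁ - m₁) * (M.Y₂ - m₂)))).const_mul (M.n / 2))).sub
      (((d2.const_sub g₁₁).const_mul (M.zz + (M.Z - m₁) ^ 2)).const_mul (M.r / 2))).sub
      (((d.sub_const (g₁₂ ^ 2 / g₁₁)).const_mul (M.ww + (M.W - m₂) ^ 2)).const_mul (M.s / 2)))
    simp only [id] at this
    norm_num at this
    linear_combination this
  · have hl : IsLocalMax (fun x => M.like m₁ m₂ g₁₁ x g₂₂) g₁₂ := by
      have e2 : ∀ᶠ x in nhds g₁₂, 0 < g₁₁ * g₂₂ - x ^ 2 :=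
        ContinuousAt.eventually_lt (by fun_prop) (by fun_prop) h2
      filter_upwards [e2] with x k2 using hmax m₁ m₂ g₁₁ x g₂₂ h1 k2
    have d := hasDerivAt_id g₁₂
    have d1 := ((d.pow 2).const_sub (g₁₁ * g₂₂)).log h2.ne'
    have := hl.hasDerivAt_eq_zero ((((((d1.const_mul ((M.n + M.r + M.s) / 2)).sub_const
      (M.r / 2 * Real.log g₂₂)).sub_const (M.s / 2 * Real.log g₁₁)).sub
      (((((d.const_mul 2).mul_const (M.s₁₂ + (M.Y₁ - m₁) * (M.Y₂ - m₂))).const_add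
        (g₁₁ * (M.s₁₁ + (M.Y₁ - m₁) ^ 2))).add_const
        (g₂₂ * (M.s₂₂ + (M.Y₂ - m₂) ^ 2))).const_mul (M.n / 2))).sub
      (((((d.pow 2).div_const g₂₂).const_sub g₁₁).const_mul
        (M.zz + (M.Z - m₁) ^ 2)).const_mul (M.r / 2))).sub
      (((((d.pow 2).div_const g₁₁).const_sub g₂₂).const_mul
        (M.ww + (M.W - m₂) ^ 2)).const_mul (M.s / 2)))
    simp only [id] at this
    norm_num at this
    linear_combination this

end Moments

/-! ### Sample moments and the log-likelihood -/

section mean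

variable {k : ℕ} (hk : 0 < k) (f g : Fin k → ℝ)

include hk in
lemma sum_sub_mul_sub (a b : ℝ) : ∑ j, (f j - a) * (g j - b) =
    k * (mean (fun j => f j * g j) - mean f * mean g + (mean f - a) * (mean g - b)) := by
  have h : (k : ℝ) ≠ 0 := by exact_mod_cast hk.ne'
  have e : ∀ j, (f j - a) * (g j - b) = f j * g j - b * f j - a * g j + a * b :=
    fun j => by ring
  simp only [e, Finset.sum_add_distrib, Finset.sum_sub_distrib, ← Finset.mul_sum, mean,
    Finset.sum_const, Finset.card_univ, Fintype.card_fin, nsmul_eq_mul, Algebra.algebraMap_self,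
    RingHom.id_apply]
  field_simp
  ring

include hk in
lemma sum_sub_sq (a : ℝ) : ∑ j, (f j - a) ^ 2 =
    k * (mean (fun j => f j ^ 2) - mean f ^ 2 + (mean f - a) ^ 2) := by
  simpa only [sq] using sum_sub_mul_sub hk f f a a

include hk in
lemma variance_nonneg : 0 ≤ mean (fun j => f j ^ 2) - mean f ^ 2 := by
  have h := sum_sub_sq hk f (mean f)
  rw [sub_self, zero_pow two_ne_zero, add_zero] at h
  have hk' : (0 : ℝ) < k := by exact_mod_cast hk
  exact nonneg_of_mul_nonneg_right (h ▸ Finset.sum_nonneg fun j _ => sq_nonneg _) hk'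

include hk in
lemma covariance_sq_le : (mean (fun j => f j * g j) - mean f * mean g) ^ 2 ≤
    (mean (fun j => f j ^ 2) - mean f ^ 2) * (mean (fun j => g j ^ 2) - mean g ^ 2) := by
  have h := Finset.sum_mul_sq_le_sq_mul_sq Finset.univ (fun j => f j - mean f)
    (fun j => g j - mean g)
  simp only [sum_sub_sq hk, sum_sub_mul_sub hk] at h
  have hk' : (0 : ℝ) < (k : ℝ) ^ 2 := by positivity
  refine le_of_mul_le_mul_left ?_ hk'
  linarith

end mean

section

variable {n r s : ℕ} (y : Fin n → Fin 2 → ℝ) (z : Fin r → ℝ) (w : Fin s → ℝ)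

/-- The moments of the data. -/
noncomputable def moments : Moments where
  n := n
  r := r
  s := s
  Y₁ := mean fun j => y j 0
  Y₂ := mean fun j => y j 1
  s₁₁ := mean (fun j => y j 0 ^ 2) - mean (fun j => y j 0) ^ 2
  s₁₂ := mean (fun j => y j 0 * y j 1) - mean (fun j => y j 0) * mean fun j => y j 1
  s₂₂ := mean (fun j => y j 1 ^ 2) - mean (fun j => y j 1) ^ 2
  Z := mean z
  zz := mean (fun j => z j ^ 2) - mean z ^ 2
  W := mean w
  ww := mean (fun j => w j ^ 2) - mean w ^ 2

lemma log_gaussianPDFReal {m g D x : ℝ} (hg : 0 < g) (hD : 0 < D) :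
    Real.log (ProbabilityTheory.gaussianPDFReal m (g / D).toNNReal x) =
      1 / 2 * Real.log D - 1 / 2 * Real.log g - 1 / 2 * Real.log (2 * Real.pi)
        - 1 / 2 * (D / g) * (x - m) ^ 2 := by
  have hv := div_pos hg hD
  have hpi : 0 < 2 * Real.pi := by positivity
  rw [ProbabilityTheory.gaussianPDFReal_def]
  simp only [Real.coe_toNNReal _ hv.le]
  rw [Real.log_mul (by positivity) (Real.exp_pos _).ne', Real.log_exp, Real.log_inv,
    Real.log_sqrt (by positivity), Real.log_mul hpi.ne' hv.ne', Real.log_div hg.ne' hD.ne']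
  field_simp
  ring

lemma log_bivariateNormalPDF {θ : Params ℝ} (hθ : θ ∈ parameterSpace) (x : Fin 2 → ℝ) :
    Real.log (bivariateNormalPDF θ.1 (concentration θ) x) =
      1 / 2 * Real.log (θ.2 0 * θ.2 2 - θ.2 1 ^ 2) - Real.log (2 * Real.pi)
        - 1 / 2 * (θ.2 0 * (x 0 - θ.1 0) ^ 2 + 2 * θ.2 1 * ((x 0 - θ.1 0) * (x 1 - θ.1 1))
          + θ.2 2 * (x 1 - θ.1 1) ^ 2) := by
  obtain ⟨-, hD⟩ := mem_parameterSpace.1 hθ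
  have hpi : 0 < 2 * Real.pi := by positivity
  have hdet : (concentration θ).det = θ.2 0 * θ.2 2 - θ.2 1 ^ 2 := by
    rw [concentration, Matrix.det_fin_two_of]; ring
  rw [bivariateNormalPDF, hdet, Real.log_mul (by positivity) (Real.exp_pos _).ne', Real.log_exp,
    Real.log_div (by positivity) hpi.ne', Real.log_sqrt hD.le]
  simp [concentration, Matrix.mulVec, dotProduct, Fin.sum_univ_two]
  ring

variable {y z w}

/-- The two functions differ by a constant on the parameter space, so they have the same maximizers
there. -/
lemma logLikelihood_eq (hn : 0 < n) (hr : 0 < r) (hs : 0 < s) {θ : Params ℝ}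
    (hθ : θ ∈ parameterSpace) : logLikelihood y z w θ =
      (moments y z w).like (θ.1 0) (θ.1 1) (θ.2 0) (θ.2 1) (θ.2 2)
        - (n + r / 2 + s / 2) * Real.log (2 * Real.pi) := by
  obtain ⟨h1, hD⟩ := mem_parameterSpace.1 hθ
  have hg2 : 0 < θ.2 2 := by
    refine pos_of_mul_pos_right (a := θ.2 0) ?_ h1.le
    nlinarith [sq_nonneg (θ.2 1)]
  have hdet : (concentration θ).det = θ.2 0 * θ.2 2 - θ.2 1 ^ 2 := by
    rw [concentration, Matrix.det_fin_two_of]; ring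
  have i1 : (concentration θ)⁻¹ 0 0 = θ.2 2 / (θ.2 0 * θ.2 2 - θ.2 1 ^ 2) := by
    rw [Matrix.inv_def, hdet, Matrix.adjugate_fin_two]
    simp [concentration, div_eq_inv_mul]
  have i2 : (concentration θ)⁻¹ 1 1 = θ.2 0 / (θ.2 0 * θ.2 2 - θ.2 1 ^ 2) := by
    rw [Matrix.inv_def, hdet, Matrix.adjugate_fin_two]
    simp [concentration, div_eq_inv_mul]
  have e1 : θ.2 0 - θ.2 1 ^ 2 / θ.2 2 = (θ.2 0 * θ.2 2 - θ.2 1 ^ 2) / θ.2 2 := by field_simp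
  have e2 : θ.2 2 - θ.2 1 ^ 2 / θ.2 0 = (θ.2 0 * θ.2 2 - θ.2 1 ^ 2) / θ.2 0 := by field_simp
  simp only [logLikelihood, i1, i2, log_gaussianPDFReal hg2 hD, log_gaussianPDFReal h1 hD,
    log_bivariateNormalPDF hθ, Finset.sum_sub_distrib, Finset.sum_add_distrib, ← Finset.mul_sum,
    sum_sub_sq hn, sum_sub_mul_sub hn, sum_sub_sq hr, sum_sub_sq hs, Finset.sum_const,
    Finset.card_univ, Fintype.card_fin, nsmul_eq_mul, Moments.like, moments, e1, e2]
  ring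

end

/-! ### The real critical point -/

section

variable {n r s : ℕ} {y : Fin n → Fin 2 → ℝ} {z : Fin r → ℝ} {w : Fin s → ℝ}

lemma mean_ofReal {k : ℕ} (f : Fin k → ℝ) : mean (fun j => (f j : ℂ)) = (mean f : ℝ) :=
  (map_mean Complex.ofRealAm f).symm

/-- Cauchy–Schwarz gives the weak inequalities. They are strict because `1` is not a root of `elim`,
whose value there contains `x * (x * z - y ^ 2)`, and because `A` and `B` are nonzero. -/
lemma moments_pos (hn : 0 < n) (hr : 0 < r) (hs : 0 < s)
    (h : (dataStats (fun j i => (y j i : ℂ)) (fun j => (z j : ℂ))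
      (fun j => (w j : ℂ))).Nondegenerate) :
    0 < (moments y z w).s₁₁ ∧
    0 < (moments y z w).s₁₁ * (moments y z w).s₂₂ - (moments y z w).s₁₂ ^ 2 ∧
    0 < (moments y z w).zz ∧ 0 < (moments y z w).ww := by
  have e := map_dataStats y z w Complex.ofRealAm
  simp only [Complex.ofRealAm_coe] at e
  rw [← e] at h
  have hone : ((dataStats y z w).map Complex.ofRealAm).elim 1 ≠ 0 := fun h0 =>
    h.ne_one 1 h0 (sub_self 1)
  rw [Stats.elim_one] at hone
  have hA : (dataStats y z w).A ≠ 0 := fun h0 => h.A_ne (by simp [Stats.map, h0])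
  have hB : (dataStats y z w).B ≠ 0 := fun h0 => h.B_ne (by simp [Stats.map, h0])
  have hxyz : (dataStats y z w).x * (dataStats y z w).z - (dataStats y z w).y ^ 2 ≠ 0 := by
    intro h0
    apply hone
    have : ((dataStats y z w).map Complex.ofRealAm).x * ((dataStats y z w).map Complex.ofRealAm).z
        - ((dataStats y z w).map Complex.ofRealAm).y ^ 2 = 0 := by
      simp only [Stats.map, Complex.ofRealAm_coe]
      exact_mod_cast h0
    rw [this, mul_zero]
  have hx : (dataStats y z w).x ≠ 0 := by
    intro h0
    apply hone
    simp [Stats.map, h0]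
  refine ⟨(variance_nonneg hn _).lt_of_ne' (left_ne_zero_of_mul hx),
    (sub_nonneg.2 (covariance_sq_le hn _ _)).lt_of_ne' fun h0 => hxyz ?_,
    (variance_nonneg hr _).lt_of_ne' (left_ne_zero_of_mul hA),
    (variance_nonneg hs _).lt_of_ne' (left_ne_zero_of_mul hB)⟩
  simp only [dataStats]
  linear_combination (shift₁ y z * shift₂ y w) ^ 2 * h0

lemma exists_local_max (hn : 0 < n) (hr : 0 < r) (hs : 0 < s)
    (h : (dataStats (fun j i => (y j i : ℂ)) (fun j => (z j : ℂ))
      (fun j => (w j : ℂ))).Nondegenerate) :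
    ∃ θ : Params ℝ, toComplex θ ∈ complexCriticalPoints y z w ∧ θ ∈ parameterSpace ∧
      IsLocalMaxOn (logLikelihood y z w) parameterSpace θ := by
  obtain ⟨p₁, p₂, p₃, p₄⟩ := moments_pos hn hr hs h
  obtain ⟨θ, hθ, hmax⟩ := Moments.exists_isMaxOn (M := moments y z w)
    (by simpa [moments] using hn) (by simpa [moments] using hr) (by simpa [moments] using hs)
    p₁ p₂ p₃ p₄
  refine ⟨θ, ?_, hθ, IsMaxOn.localize fun η hη => ?_⟩
  · obtain ⟨h1, hD⟩ := mem_parameterSpace.1 hθ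
    have hg2 : 0 < θ.2 2 := by
      refine pos_of_mul_pos_right (a := θ.2 0) ?_ h1.le
      nlinarith [sq_nonneg (θ.2 1)]
    have hdet : (concentration (toComplex θ)).det = (θ.2 0 * θ.2 2 - θ.2 1 ^ 2 : ℝ) := by
      rw [concentration, Matrix.det_fin_two_of]
      simp [toComplex]
      ring
    obtain ⟨k₁, k₂, k₃, k₄, k₅⟩ := Moments.score_of_isMaxOn hθ hmax
    have e1 : θ.2 0 - θ.2 1 ^ 2 / θ.2 2 = (θ.2 0 * θ.2 2 - θ.2 1 ^ 2) / θ.2 2 := by field_simp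
    have e2 : θ.2 2 - θ.2 1 ^ 2 / θ.2 0 = (θ.2 0 * θ.2 2 - θ.2 1 ^ 2) / θ.2 0 := by field_simp
    rw [e1] at k₁
    rw [e2] at k₂
    simp only [moments] at k₁ k₂ k₃ k₄ k₅
    simp only [complexCriticalPoints, Set.mem_ofPred_eq, IsCriticalPoint, average_eq_mean]
    rw [hdet]
    simp only [toComplex, ← Complex.ofReal_mul, ← Complex.ofReal_pow, mean_ofReal]
    replace k₁ := congrArg Complex.ofReal k₁
    replace k₂ := congrArg Complex.ofReal k₂
    replace k₃ := congrArg Complex.ofReal k₃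
    replace k₄ := congrArg Complex.ofReal k₄
    replace k₅ := congrArg Complex.ofReal k₅
    push_cast at k₁ k₂ k₃ k₄ k₅
    refine ⟨by exact_mod_cast h1.ne', by exact_mod_cast hg2.ne', by exact_mod_cast hD.ne',
      ?_, ?_, ?_, ?_, ?_⟩ <;> push_cast
    · linear_combination k₁
    · linear_combination k₂
    · linear_combination k₃
    · linear_combination k₄
    · linear_combination k₅
  · have := hmax hη
    simp only [Set.mem_ofPred_eq, logLikelihood_eq hn hr hs hθ, logLikelihood_eq hn hr hs hη] at this ⊢
    linarith

end

end BivariateMissing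

theorem mainTheorem3 (n r s : ℕ) (hn : 3 ≤ n) (hr : 2 ≤ r) (hs : 2 ≤ s) :
    BivariateMissing.IsMLDegree n r s 9 ∧
    BivariateMissing.ForGenericData n r s (fun y z w =>
      ∃ θ : BivariateMissing.Params ℝ,
        BivariateMissing.toComplex θ ∈ BivariateMissing.complexCriticalPoints y z w) ∧
    BivariateMissing.ForGenericData n r s (fun y z w =>
      ∃ θ : BivariateMissing.Params ℝ,
        BivariateMissing.toComplex θ ∈ BivariateMissing.complexCriticalPoints y z w ∧
        θ ∈ BivariateMissing.parameterSpace ∧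
        IsLocalMaxOn (BivariateMissing.logLikelihood y z w)
          BivariateMissing.parameterSpace θ) := by
  -- The same nondegeneracy polynomial serves for all three statements.
  obtain ⟨F, hF, h⟩ := BivariateMissing.exists_nondegenerate_polynomial hn hr hs
  have key := fun y z w hyzw => BivariateMissing.exists_local_max (by omega) (by omega) (by omega)
    (h y z w hyzw)
  refine ⟨BivariateMissing.isMLDegree_nine hn hr hs, ⟨F, hF, fun y z w hyzw => ?_⟩, F, hF, key⟩
  obtain ⟨θ, hθ, -⟩ := key y z w hyzw
  exact ⟨θ, hθ⟩
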